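/- For real $\lambda,\theta,\omega$ let $H=H_{\lambda,\theta,\omega}$ be the almost Mathieu operator on $\ell^2(\mathbb Z)$, $$(H\psi)(n)=\psi(n+1)+\psi(n-1)+\lambda\cos\bigl(2\pi(n\theta+\omega)\bigr)\psi(n).$$ For $T>0$, $n\in\mathbb Z$, $N\in\mathbb R$ and $p>0$ put $$a(n,T)=\frac2T\int_0^\infty e^{-2t/T}\,|\langle e^{-itH}\delta_1,\delta_n\rangle|^2\,dt,\qquad P(N,T)=\sum_{|n|>N}a(n,T),\qquad \langle|X|^p\rangle(T)=\sum_{n\in\mathbb Z}|n|^p a(n,T),$$ and, with $\log 0=-\infty$, $$S^-(\alpha)=-\liminf_{T\to\infty}\frac{\log P(T^\alpha-2,T)}{\log T},\qquad S^+(\alpha)=-\limsup_{T\to\infty}\frac{\log P(T^\alpha-2,T)}{\log T},\qquad \alpha_u^\pm=\sup\{\alpha\ge0: S^\pm(\alpha)<\infty\},$$ $$\beta^-(p)=\liminf_{T\to\infty}\frac{\log\langle|X|^p\rangle(T)}{p\log T},\qquad \beta^+(p)=\limsup_{T\to\infty}\frac{\log\langle|X|^p\rangle(T)}{p\log T}.$$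 All of these quantities depend on $\lambda,\theta,\omega$. **Theorem.** Let $\lambda>2$ and let $\theta$ be irrational. Then for every $\omega\in[0,1)$ we have $\alpha_u^-=0$, and hence $\beta^-(p)=0$ for every $p>0$. If in addition $\lim_{k\to\infty}\frac{\log q_{k+1}}{q_k}=0$, where $q_k$ ($k\ge 0$) are the denominators of the continued fraction approximants $p_k/q_k$ of $\theta$, then for every $\omega\in[0,1)$ we have $\alpha_u^+=0$, and hence $\beta^+(p)=0$ for every $p>0$. -/

import Mathlib

open scoped lp ENNReal

/-- The shift `(shift k ψ)(n) = ψ(n + k)` on `ℓ²(ℤ)`. -/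
noncomputable def shift (k : ℤ) : ℓ²(ℤ, ℂ) →L[ℂ] ℓ²(ℤ, ℂ) :=
  LinearMap.mkContinuous
    { toFun := fun ψ => ⟨fun n => ψ (n + k), by
        have h := (lp.memℓp ψ).summable (by norm_num)
        exact memℓp_gen ((Equiv.addRight k).summable_iff.mpr h)⟩
      map_add' := fun _ _ => rfl
      map_smul' := fun _ _ => rfl } 1 (by
    intro ψ
    refine lp.norm_le_of_tsum_le (by norm_num) (by positivity) ?_
    rw [one_mul, lp.norm_rpow_eq_tsum (by norm_num) ψ]
    exact ((Equiv.addRight k).tsum_eq (fun n => ‖ψ n‖ ^ (2 : ℝ≥0∞).toReal)).le)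

theorem memlp_mul_bounded (V : ℤ → ℝ) (hV : ∃ C, ∀ n, |V n| ≤ C) (ψ : ℓ²(ℤ, ℂ)) :
    Memℓp (fun n : ℤ => (V n : ℂ) * ψ n) 2 := by
  obtain ⟨C, hC⟩ := hV
  refine Memℓp.mono (g := fun n => |C| * ‖ψ n‖) ?_ fun n => ?_
  · exact (memℓp_norm_iff.mpr (lp.memℓp ψ)).const_mul (𝕜 := ℝ) |C|
  · rw [norm_mul, Complex.norm_real, Real.norm_eq_abs]
    exact mul_le_mul_of_nonneg_right ((hC n).trans (le_abs_self C)) (norm_nonneg (ψ n))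

/-- The operator of multiplication by a bounded real function `V` on `ℓ²(ℤ)`. -/
noncomputable def mulPotential (V : ℤ → ℝ) (hV : ∃ C, ∀ n, |V n| ≤ C) :
    ℓ²(ℤ, ℂ) →L[ℂ] ℓ²(ℤ, ℂ) :=
  LinearMap.mkContinuousOfExistsBound
    { toFun := fun ψ => ⟨fun n => (V n : ℂ) * ψ n, memlp_mul_bounded V hV ψ⟩
      map_add' := fun ψ φ => lp.ext (funext fun n => mul_add (V n : ℂ) (ψ n) (φ n))
      map_smul' := fun c ψ => lp.ext (funext fun n => mul_left_comm (V n : ℂ) c (ψ n)) } (by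
    obtain ⟨C, hC⟩ := hV
    refine ⟨|C|, fun ψ => ?_⟩
    have h : ‖((C : ℂ) • ψ : ℓ²(ℤ, ℂ))‖ = |C| * ‖ψ‖ := by
      rw [norm_smul, Complex.norm_real, Real.norm_eq_abs]
    rw [← h]
    refine lp.norm_mono (by norm_num) fun n => ?_
    change ‖(V n : ℂ) * ψ n‖ ≤ ‖(C : ℂ) * ψ n‖
    simp only [norm_mul, Complex.norm_real, Real.norm_eq_abs]
    exact mul_le_mul_of_nonneg_right ((hC n).trans (le_abs_self C)) (norm_nonneg _))

/-- The discrete Schrödinger operator on `ℓ²(ℤ)` with bounded real potential `V`. -/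
noncomputable def schrodingerOp (V : ℤ → ℝ) (hV : ∃ C, ∀ n, |V n| ≤ C) :
    ℓ²(ℤ, ℂ) →L[ℂ] ℓ²(ℤ, ℂ) :=
  shift 1 + shift (-1) + mulPotential V hV

theorem schrodingerOp_apply (V : ℤ → ℝ) (hV : ∃ C, ∀ n, |V n| ≤ C) (ψ : ℓ²(ℤ, ℂ)) (n : ℤ) :
    schrodingerOp V hV ψ n = ψ (n + 1) + ψ (n - 1) + (V n : ℂ) * ψ n := rfl

/-- The almost Mathieu potential with coupling `lam`, frequency `θ` and phase `ω`. -/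
noncomputable def amoPotential (lam θ ω : ℝ) (n : ℤ) : ℝ :=
  lam * Real.cos (2 * Real.pi * (n * θ + ω))

theorem amoPotential_bounded (lam θ ω : ℝ) : ∃ C, ∀ n, |amoPotential lam θ ω n| ≤ C := by
  refine ⟨|lam|, fun n => ?_⟩
  rw [amoPotential, abs_mul]
  exact mul_le_of_le_one_right (abs_nonneg _) (Real.abs_cos_le_one _)

/-- The almost Mathieu operator on `ℓ²(ℤ)`. -/
noncomputable def almostMathieu (lam θ ω : ℝ) : ℓ²(ℤ, ℂ) →L[ℂ] ℓ²(ℤ, ℂ) :=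
  schrodingerOp (amoPotential lam θ ω) (amoPotential_bounded lam θ ω)

/-- The unit vector `δ_n` of `ℓ²(ℤ)`. -/
noncomputable def delta (n : ℤ) : ℓ²(ℤ, ℂ) := lp.single 2 n 1

/-- The propagator `e^{-itH}`. -/
noncomputable def propagator (H : ℓ²(ℤ, ℂ) →L[ℂ] ℓ²(ℤ, ℂ)) (t : ℝ) :
    ℓ²(ℤ, ℂ) →L[ℂ] ℓ²(ℤ, ℂ) :=
  NormedSpace.exp ((-(Complex.I * (t : ℂ))) • H)

/-- The time-averaged probability
`a(n,T) = (2/T) ∫_0^∞ e^{-2t/T} |⟨δ_n, e^{-itH} δ_1⟩|² dt`. -/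
noncomputable def avgProb (H : ℓ²(ℤ, ℂ) →L[ℂ] ℓ²(ℤ, ℂ)) (n : ℤ) (T : ℝ) : ℝ≥0∞ :=
  ∫⁻ t in Set.Ioi (0 : ℝ), ENNReal.ofReal
    (2 / T * (Real.exp (-2 * t / T) * ‖inner ℂ (delta n) (propagator H t (delta 1))‖ ^ 2))

/-- The time-averaged outside probability `P(N,T) = ∑_{|n| > N} a(n,T)`, for real `N`. -/
noncomputable def outsideProb (H : ℓ²(ℤ, ℂ) →L[ℂ] ℓ²(ℤ, ℂ)) (N T : ℝ) : ℝ≥0∞ :=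
  ∑' n : {n : ℤ // N < |(n : ℝ)|}, avgProb H n T

/-- The time-averaged moment `⟨|X|^p⟩(T) = ∑_n |n|^p a(n,T)`. -/
noncomputable def avgMoment (H : ℓ²(ℤ, ℂ) →L[ℂ] ℓ²(ℤ, ℂ)) (p T : ℝ) : ℝ≥0∞ :=
  ∑' n : ℤ, ENNReal.ofReal (|(n : ℝ)| ^ p) * avgProb H n T

/-- `log P(T^α - 2, T) / log T`, with values in `[-∞, ∞]` and `log 0 = -∞`. -/
noncomputable def tailRate (H : ℓ²(ℤ, ℂ) →L[ℂ] ℓ²(ℤ, ℂ)) (α T : ℝ) : EReal :=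
  ENNReal.log (outsideProb H (T ^ α - 2) T) / (Real.log T : EReal)

/-- `S^-(α)`. -/
noncomputable def SMinus (H : ℓ²(ℤ, ℂ) →L[ℂ] ℓ²(ℤ, ℂ)) (α : ℝ) : EReal :=
  -Filter.liminf (fun T : ℝ => tailRate H α T) Filter.atTop

/-- `S^+(α)`. -/
noncomputable def SPlus (H : ℓ²(ℤ, ℂ) →L[ℂ] ℓ²(ℤ, ℂ)) (α : ℝ) : EReal :=
  -Filter.limsup (fun T : ℝ => tailRate H α T) Filter.atTop

/-- `α_u^- = sup {α ≥ 0 : S^-(α) < ∞}`. (The value `α = ∞` never belongs to the set, since then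
the outside probability is zero and `S^-(∞) = ∞`.) -/
noncomputable def alphaUMinus (H : ℓ²(ℤ, ℂ) →L[ℂ] ℓ²(ℤ, ℂ)) : EReal :=
  sSup ((fun α : ℝ => (α : EReal)) '' {α : ℝ | 0 ≤ α ∧ SMinus H α < ⊤})

/-- `α_u^+ = sup {α ≥ 0 : S^+(α) < ∞}`. -/
noncomputable def alphaUPlus (H : ℓ²(ℤ, ℂ) →L[ℂ] ℓ²(ℤ, ℂ)) : EReal :=
  sSup ((fun α : ℝ => (α : EReal)) '' {α : ℝ | 0 ≤ α ∧ SPlus H α < ⊤})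

/-- The lower transport exponent `β^-(p)`. -/
noncomputable def betaMinus (H : ℓ²(ℤ, ℂ) →L[ℂ] ℓ²(ℤ, ℂ)) (p : ℝ) : EReal :=
  Filter.liminf (fun T : ℝ => ENNReal.log (avgMoment H p T) / ((p * Real.log T : ℝ) : EReal))
    Filter.atTop

/-- The upper transport exponent `β^+(p)`. -/
noncomputable def betaPlus (H : ℓ²(ℤ, ℂ) →L[ℂ] ℓ²(ℤ, ℂ)) (p : ℝ) : EReal :=
  Filter.limsup (fun T : ℝ => ENNReal.log (avgMoment H p T) / ((p * Real.log T : ℝ) : EReal))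
    Filter.atTop

/-- The denominator `q_k` of the `k`-th continued fraction approximant of `θ`. -/
noncomputable def cfDenom (θ : ℝ) (k : ℕ) : ℝ := (GenContFract.of θ).dens k

/-- The weak Brjuno condition `log q_{k+1} / q_k → 0`. -/
def WeakBrjuno (θ : ℝ) : Prop :=
  Filter.Tendsto (fun k : ℕ => Real.log (cfDenom θ (k + 1)) / cfDenom θ k)
    Filter.atTop (nhds 0)

/-!
With `ε = 1 / (2T)` and `z = E + iε`, the Laplace transform `φₙ(z) = ∫₀^∞ e^{izt} ψₙ(t) dt` of the
amplitudes `ψₙ(t) = ⟨δₙ, e^{-itH} δ₁⟩` is bounded by `1 / ε` and solves `Hφ = zφ` away from the site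
`1` (`IsEvolution.laplace_eq`). By Fourier inversion (`IsEvolution.norm_le_of_laplace_le`) the
averaged probability `a(n,T)` is small as soon as `(1 + E²) |φₙ(E + iε)|` is small uniformly in `E`.
So it is enough to bound bounded solutions on a half line; the left half line becomes a right one by
reflection, which only changes the phase `ω`, and every estimate is uniform in the phase.

Let `u` be the solution with `u(m) = 0` and `u(m+1) = 1`. The currents `Im (conj φₙ φₙ₊₁)` and
`Im (conj uₙ uₙ₊₁)` have opposite signs when `Im z > 0`, hence the two terms of the Wronskian of `φ`
and `u` cannot cancel, and `|φ|` is at most `ε⁻² / |u|`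
(`IsHalfLineSol.norm_mul_dirichletSol_le`). The same current identity shows that the mass of `φ` to
the right of a site decreases at an exponential rate of order `ε`. A single site at distance at most
`T ^ α / 8` at which `u` is a large power of `T` therefore makes `φₙ` smaller than any power of `T`
and of `n` for `n ≥ T ^ α / 2` (`exists_halfLine_bound`).

Growth of `u` comes from its dependence on the phase: `k` sites after its start, `u` is a
trigonometric polynomial of degree `k` in the phase whose extreme Fourier coefficient has modulus
`(λ / 2) ^ k`, whatever the energy. Averaging `k` times over blocks of length `L` of the orbit of the
rotation by `θ` isolates this coefficient as soon as `L` is a large multiple of the inverse of the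
smallest divisor `|1 - e^{2πijθ}|`, `1 ≤ j ≤ 2k`; hence one of the first `k L` starting points has
`|u| ≥ (λ / 2) ^ k / 2` (`exists_le_norm_dirichletSol`). With `k` a large multiple of `log T` this
site lies within `T ^ α / 8` provided the small divisors at scale `k` are at worst `e^{-δk}` with a
small `δ`. For irrational `θ` this holds for a quarter of each large convergent denominator, that is,
along a sequence of times (`frequently_phaseGap`); under the weak Brjuno condition it holds at all
large scales (`eventually_phaseGap`).

The moments are bounded below because a fixed fraction of the mass escapes from the site `0`
(`avgProb_zero_le`), and so the transport exponents are nonnegative.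
-/

/-! ### Solutions of the difference equation on a half line -/

/-- `φ` solves `φ(n+1) + φ(n-1) + V(n) φ(n) = z φ(n)` at all sites `n ≥ 1`. -/
def IsHalfLineSol (V : ℕ → ℝ) (z : ℂ) (φ : ℕ → ℂ) : Prop :=
  ∀ n, φ (n + 2) = (z - V (n + 1)) * φ (n + 1) - φ n

/-- The current `Im (conj φ(n) · φ(n+1))` of a sequence through the bond `(n, n+1)`. -/
noncomputable def current (φ : ℕ → ℂ) (n : ℕ) : ℝ := (starRingEnd ℂ (φ n) * φ (n + 1)).im

/-- The solution `u` on the sites `0, 1, …` with `u(-1) = 0` and `u(0) = 1`. -/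
noncomputable def dirichletSol (V : ℕ → ℝ) (z : ℂ) : ℕ → ℂ
  | 0 => 1
  | 1 => z - V 0
  | k + 2 => (z - V (k + 1)) * dirichletSol V z (k + 1) - dirichletSol V z k

theorem isHalfLineSol_dirichletSol (V : ℕ → ℝ) (z : ℂ) :
    IsHalfLineSol V z (dirichletSol V z) := fun n => by rw [dirichletSol]

theorem IsHalfLineSol.current_succ {V : ℕ → ℝ} {z : ℂ} {φ : ℕ → ℂ} (h : IsHalfLineSol V z φ)
    (n : ℕ) : current φ (n + 1) = current φ n + z.im * ‖φ (n + 1)‖ ^ 2 := by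
  rw [current, current, show n + 1 + 1 = n + 2 from rfl, h n, ← Complex.normSq_eq_norm_sq,
    Complex.normSq_apply]
  simp only [Complex.mul_im, Complex.conj_re, Complex.conj_im, Complex.sub_re, Complex.sub_im,
    Complex.mul_re, Complex.ofReal_re, Complex.ofReal_im]
  ring

theorem abs_current_le (φ : ℕ → ℂ) (n : ℕ) : |current φ n| ≤ ‖φ n‖ * ‖φ (n + 1)‖ := by
  refine (Complex.abs_im_le_norm _).trans ?_
  rw [norm_mul, RCLike.norm_conj]

theorem le_current_dirichletSol (V : ℕ → ℝ) {z : ℂ} (hz : 0 ≤ z.im) (k : ℕ) :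
    z.im * ‖dirichletSol V z k‖ ^ 2 ≤ current (dirichletSol V z) k := by
  have hpos : ∀ k, 0 ≤ current (dirichletSol V z) k := by
    intro k
    induction k with
    | zero => simpa [current, dirichletSol] using hz
    | succ k ih =>
      rw [(isHalfLineSol_dirichletSol V z).current_succ]
      positivity
  cases k with
  | zero => simp [current, dirichletSol]
  | succ k =>
    rw [(isHalfLineSol_dirichletSol V z).current_succ]
    linarith [hpos k]

section Bounded

variable {V : ℕ → ℝ} {z : ℂ} {φ : ℕ → ℂ} {M : ℝ}

/-- Conservation law: between two bonds the current grows by the mass on the sites in between,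
weighted by `Im z`. -/
theorem IsHalfLineSol.sum_sq (h : IsHalfLineSol V z φ) (n k : ℕ) :
    current φ (n + k) - current φ n = z.im * ∑ j ∈ Finset.range k, ‖φ (n + 1 + j)‖ ^ 2 := by
  induction k with
  | zero => simp
  | succ k ih =>
    rw [Finset.sum_range_succ, mul_add, ← ih, ← add_assoc, h.current_succ,
      show n + k + 1 = n + 1 + k by ring]
    ring

theorem IsHalfLineSol.summable_sq (h : IsHalfLineSol V z φ) (hz : 0 < z.im)
    (hM : ∀ n, ‖φ n‖ ≤ M) : Summable fun n => ‖φ n‖ ^ 2 := by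
  have hM0 : 0 ≤ M := (norm_nonneg _).trans (hM 0)
  have hJ : ∀ n, |current φ n| ≤ M ^ 2 := fun n =>
    (abs_current_le φ n).trans (by rw [sq]; gcongr <;> exact hM _)
  rw [← summable_nat_add_iff 1]
  refine summable_of_sum_range_le (c := 2 * M ^ 2 / z.im) (fun _ => by positivity) fun k => ?_
  rw [le_div_iff₀ hz, mul_comm]
  have := h.sum_sq 0 k
  have h1 := abs_le.1 (hJ (0 + k))
  have h2 := abs_le.1 (hJ 0)
  simp only [add_comm 1, zero_add] at *
  linarith [h1.2, h2.1]

/-- The current of a bounded solution vanishes at infinity, so it equals minus the mass to its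
right, weighted by `Im z`. -/
theorem IsHalfLineSol.hasSum_sq (h : IsHalfLineSol V z φ) (hz : 0 < z.im)
    (hM : ∀ n, ‖φ n‖ ≤ M) (n : ℕ) :
    z.im * ∑' j, ‖φ (n + 1 + j)‖ ^ 2 = -current φ n := by
  have hs := h.summable_sq hz hM
  have h0 : Filter.Tendsto (fun n => ‖φ n‖) Filter.atTop (nhds 0) := by
    have := (hs.tendsto_atTop_zero).sqrt
    simpa using this
  have hJ0 : Filter.Tendsto (fun k => current φ (n + k)) Filter.atTop (nhds 0) := by
    refine squeeze_zero_norm (fun k => abs_current_le φ (n + k)) ?_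
    have h1 := h0.comp (Filter.tendsto_add_atTop_nat n)
    have h2 := h0.comp (Filter.tendsto_add_atTop_nat (n + 1))
    have := h1.mul h2
    rw [mul_zero] at this
    refine this.congr fun k => ?_
    change ‖φ (k + n)‖ * ‖φ (k + (n + 1))‖ = _
    rw [add_comm k n, show k + (n + 1) = n + k + 1 by ring]
  have hs' : Summable fun j => ‖φ (n + 1 + j)‖ ^ 2 := by
    have := (summable_nat_add_iff (n + 1)).2 hs
    simpa [add_comm, add_left_comm] using this
  have hlim := (hs'.hasSum.tendsto_sum_nat).const_mul z.im
  have hlim2 : Filter.Tendsto (fun k => z.im * ∑ j ∈ Finset.range k, ‖φ (n + 1 + j)‖ ^ 2)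
      Filter.atTop (nhds (-current φ n)) := by
    have := hJ0.sub_const (current φ n)
    rw [zero_sub] at this
    exact this.congr fun k => h.sum_sq n k
  exact tendsto_nhds_unique hlim hlim2

theorem IsHalfLineSol.current_nonpos (h : IsHalfLineSol V z φ) (hz : 0 < z.im)
    (hM : ∀ n, ‖φ n‖ ≤ M) (n : ℕ) : current φ n ≤ 0 := by
  have := h.hasSum_sq hz hM n
  have h2 : 0 ≤ z.im * ∑' j, ‖φ (n + 1 + j)‖ ^ 2 :=
    mul_nonneg hz.le (tsum_nonneg fun _ => by positivity)
  linarith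

theorem IsHalfLineSol.tail_le (h : IsHalfLineSol V z φ) (hz : 0 < z.im)
    (hM : ∀ n, ‖φ n‖ ≤ M) (n : ℕ) :
    z.im * ∑' j, ‖φ (n + 1 + j)‖ ^ 2 ≤ ‖φ n‖ * ‖φ (n + 1)‖ := by
  rw [h.hasSum_sq hz hM n]
  exact (neg_le_abs _).trans (abs_current_le φ n)

/-- Each two sites reduce the tail mass of a bounded solution by the factor `1 + 2 Im z`. -/
theorem IsHalfLineSol.tail_step (h : IsHalfLineSol V z φ) (hz : 0 < z.im)
    (hM : ∀ n, ‖φ n‖ ≤ M) (n : ℕ) :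
    (1 + 2 * z.im) * ∑' j, ‖φ (n + 2 + j)‖ ^ 2 ≤ ∑' j, ‖φ (n + j)‖ ^ 2 := by
  have hs := h.summable_sq hz hM
  have hs' : ∀ n, Summable fun j => ‖φ (n + j)‖ ^ 2 := fun n => by
    simpa [add_comm] using (summable_nat_add_iff n).2 hs
  have e : ∀ n, ∑' j, ‖φ (n + j)‖ ^ 2 = ‖φ n‖ ^ 2 + ∑' j, ‖φ (n + 1 + j)‖ ^ 2 := fun n => by
    rw [(hs' n).tsum_eq_zero_add]
    simp [add_comm, add_left_comm]
  have h1 := h.tail_le hz hM n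
  have e1 := e n
  have e2 := e (n + 1)
  rw [show n + 1 + 1 = n + 2 from rfl] at e2
  have h3 : 0 ≤ z.im * ‖φ (n + 1)‖ ^ 2 := by positivity
  rw [e2, mul_add] at h1
  nlinarith [sq_nonneg (‖φ n‖ - ‖φ (n + 1)‖)]

theorem IsHalfLineSol.tail_iterate (h : IsHalfLineSol V z φ) (hz : 0 < z.im)
    (hM : ∀ n, ‖φ n‖ ≤ M) (n i : ℕ) :
    (1 + 2 * z.im) ^ i * ∑' j, ‖φ (n + 2 * i + j)‖ ^ 2 ≤ ∑' j, ‖φ (n + j)‖ ^ 2 := by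
  induction i with
  | zero => simp
  | succ i ih =>
    refine le_trans ?_ ih
    rw [pow_succ, mul_assoc]
    gcongr
    exact h.tail_step hz hM (n + 2 * i)

/-- Constancy of the Wronskian of `φ` and the Dirichlet solution started at site `m + 1`. -/
theorem IsHalfLineSol.wronskian (h : IsHalfLineSol V z φ) (m k : ℕ) :
    φ (m + 1 + k) * dirichletSol (fun j => V (m + 1 + j)) z (k + 1) -
      φ (m + 1 + k + 1) * dirichletSol (fun j => V (m + 1 + j)) z k = φ m := by
  induction k with
  | zero =>
    have := h m
    simp only [dirichletSol, add_zero] at *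
    rw [show m + 1 + 1 = m + 2 from rfl, this]; ring
  | succ k ih =>
    have := h (m + 1 + k)
    rw [dirichletSol, ← ih]
    rw [show m + 1 + (k + 1) + 1 = m + 1 + k + 2 by ring,
      show m + 1 + (k + 1) = m + 1 + k + 1 by ring, this]
    ring

/-- A large Dirichlet solution forces a bounded solution to be small: the currents of the two
solutions have opposite signs, so the two terms of the Wronskian cannot cancel. -/
theorem IsHalfLineSol.norm_mul_dirichletSol_le (h : IsHalfLineSol V z φ) (hz : 0 < z.im)
    (hM : ∀ n, ‖φ n‖ ≤ M) (m k : ℕ) :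
    z.im * (‖φ (m + 1 + k)‖ * ‖dirichletSol (fun j => V (m + 1 + j)) z k‖) ≤ ‖φ m‖ := by
  set u := dirichletSol (fun j => V (m + 1 + j)) z with hu
  have hW := h.wronskian m k
  rw [← hu] at hW
  have hJφ := h.current_nonpos hz hM (m + 1 + k)
  have hJu := le_current_dirichletSol (fun j => V (m + 1 + j)) hz.le k
  rw [← hu] at hJu
  set a := φ (m + 1 + k) with ha
  have key : (φ m * starRingEnd ℂ a * starRingEnd ℂ (u k)).im
      = ‖a‖ ^ 2 * current u k - ‖u k‖ ^ 2 * current φ (m + 1 + k) := by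
    rw [← hW, current, current, ← ha, ← Complex.normSq_eq_norm_sq, ← Complex.normSq_eq_norm_sq,
      Complex.normSq_apply, Complex.normSq_apply]
    simp only [Complex.mul_im, Complex.conj_re, Complex.conj_im, Complex.sub_re, Complex.sub_im,
      Complex.mul_re]
    ring
  have h1 : ‖a‖ ^ 2 * (z.im * ‖u k‖ ^ 2) ≤ ‖φ m‖ * ‖a‖ * ‖u k‖ := by
    calc ‖a‖ ^ 2 * (z.im * ‖u k‖ ^ 2) ≤ ‖a‖ ^ 2 * current u k := by gcongr
      _ ≤ ‖a‖ ^ 2 * current u k - ‖u k‖ ^ 2 * current φ (m + 1 + k) := by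
        have : ‖u k‖ ^ 2 * current φ (m + 1 + k) ≤ 0 :=
          mul_nonpos_of_nonneg_of_nonpos (by positivity) hJφ
        linarith
      _ ≤ ‖φ m * starRingEnd ℂ a * starRingEnd ℂ (u k)‖ := by
        rw [← key]; exact (le_abs_self _).trans (Complex.abs_im_le_norm _)
      _ = _ := by simp
  rcases (mul_nonneg (norm_nonneg a) (norm_nonneg (u k))).eq_or_lt with h0 | h0
  · rw [← h0, mul_zero]; exact norm_nonneg _
  · refine le_of_mul_le_mul_right ?_ h0
    nlinarith

/-- Decay of a bounded solution behind a site at which a Dirichlet solution is large. -/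
theorem IsHalfLineSol.sq_norm_le (h : IsHalfLineSol V z φ) (hz : 0 < z.im)
    (hM : ∀ n, ‖φ n‖ ≤ M) {m k : ℕ} {B : ℝ} (hB : 0 < B)
    (hu : B ≤ ‖dirichletSol (fun j => V (m + 1 + j)) z k‖) {i j : ℕ}
    (hj : m + k + 2 + 2 * i ≤ j) :
    ‖φ j‖ ^ 2 * (1 + 2 * z.im) ^ i ≤ M ^ 2 / (z.im ^ 2 * B) := by
  have hM0 : 0 ≤ M := (norm_nonneg _).trans (hM 0)
  obtain ⟨s, rfl⟩ := Nat.exists_eq_add_of_le hj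
  have h1 := h.norm_mul_dirichletSol_le hz hM m k
  have h2 := h.tail_le hz hM (m + 1 + k)
  have h3 := h.tail_iterate hz hM (m + 1 + k + 1) i
  have h4 : ‖φ (m + k + 2 + 2 * i + s)‖ ^ 2 ≤ ∑' j, ‖φ (m + 1 + k + 1 + 2 * i + j)‖ ^ 2 := by
    have hs : Summable fun j => ‖φ (m + 1 + k + 1 + 2 * i + j)‖ ^ 2 := by
      simpa [add_comm] using (summable_nat_add_iff (m + 1 + k + 1 + 2 * i)).2 (h.summable_sq hz hM)
    have := hs.le_tsum s (fun _ _ => by positivity)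
    rwa [show m + 1 + k + 1 + 2 * i + s = m + k + 2 + 2 * i + s by ring] at this
  have h5 : ‖φ (m + 1 + k)‖ * (z.im * B) ≤ M := by
    calc _ = z.im * (‖φ (m + 1 + k)‖ * B) := by ring
      _ ≤ _ := by gcongr
      _ ≤ _ := h1
      _ ≤ _ := hM _
  rw [le_div_iff₀ (by positivity)]
  calc ‖φ (m + k + 2 + 2 * i + s)‖ ^ 2 * (1 + 2 * z.im) ^ i * (z.im ^ 2 * B)
      ≤ (∑' j, ‖φ (m + 1 + k + 1 + 2 * i + j)‖ ^ 2) * (1 + 2 * z.im) ^ i * (z.im ^ 2 * B) := by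
        gcongr
    _ = ((1 + 2 * z.im) ^ i * ∑' j, ‖φ (m + 1 + k + 1 + 2 * i + j)‖ ^ 2) * (z.im ^ 2 * B) := by
        ring
    _ ≤ (∑' j, ‖φ (m + 1 + k + 1 + j)‖ ^ 2) * (z.im ^ 2 * B) := by gcongr
    _ = (z.im * ∑' j, ‖φ (m + 1 + k + 1 + j)‖ ^ 2) * (z.im * B) := by ring
    _ ≤ (‖φ (m + 1 + k)‖ * ‖φ (m + 1 + k + 1)‖) * (z.im * B) := by gcongr
    _ = (‖φ (m + 1 + k)‖ * (z.im * B)) * ‖φ (m + 1 + k + 1)‖ := by ring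
    _ ≤ M * M := by gcongr; exact hM _
    _ = M ^ 2 := by ring

end Bounded

theorem le_norm_dirichletSol_succ {V : ℕ → ℝ} {z : ℂ} {l : ℝ} (hV : ∀ n, |V n| ≤ l)
    (hz : l + 2 ≤ ‖z‖) (k : ℕ) :
    (‖z‖ - l - 1) * ‖dirichletSol V z k‖ ≤ ‖dirichletSol V z (k + 1)‖ := by
  have hsub : ∀ n, ‖z‖ - l ≤ ‖z - V n‖ := fun n => by
    have h1 := norm_sub_norm_le z (V n : ℂ)
    rw [Complex.norm_real, Real.norm_eq_abs] at h1
    linarith [hV n]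
  induction k with
  | zero =>
    simp only [dirichletSol, norm_one]
    linarith [hsub 0]
  | succ k ih =>
    rw [dirichletSol]
    have h1 := norm_sub_norm_le ((z - V (k + 1)) * dirichletSol V z (k + 1)) (dirichletSol V z k)
    rw [norm_mul] at h1
    have h2 := mul_le_mul_of_nonneg_right (hsub (k + 1)) (norm_nonneg (dirichletSol V z (k + 1)))
    have h3 : ‖dirichletSol V z k‖ ≤ ‖dirichletSol V z (k + 1)‖ := by
      nlinarith [norm_nonneg (dirichletSol V z k)]
    linarith

theorem pow_le_norm_dirichletSol {V : ℕ → ℝ} {z : ℂ} {l : ℝ} (hV : ∀ n, |V n| ≤ l)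
    (hz : l + 2 ≤ ‖z‖) (k : ℕ) : (‖z‖ - l - 1) ^ k ≤ ‖dirichletSol V z k‖ := by
  induction k with
  | zero => simp [dirichletSol]
  | succ k ih =>
    rw [pow_succ, mul_comm]
    exact (mul_le_mul_of_nonneg_left ih (by linarith)).trans (le_norm_dirichletSol_succ hV hz k)

/-! ### Growth of Dirichlet solutions along an orbit of the rotation -/

/-- Iterating averages over blocks of length `L` isolates the constant Fourier mode of an almost
periodic sequence; each average multiplies the other modes by at most `ρ`. -/
theorem norm_constant_mode_le {d L : ℕ} (hL : 0 < L) {η : ℕ → ℂ} {ρ M : ℝ}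
    (hη : ∀ j < d, ‖∑ i ∈ Finset.range L, η j ^ i‖ ≤ L * ρ) (b₀ : ℂ) (r : ℕ) (b : ℕ → ℂ)
    (hM : ∀ m ≤ r * L, ‖b₀ + ∑ j ∈ Finset.range d, b j * η j ^ m‖ ≤ M) :
    ‖b₀‖ ≤ M + ∑ j ∈ Finset.range d, ‖b j‖ * ρ ^ r := by
  have hL' : (0 : ℝ) < L := by exact_mod_cast hL
  induction r generalizing b with
  | zero =>
    have h := hM 0 (by simp)
    simp only [pow_zero, mul_one] at *
    have h1 := norm_sub_le (b₀ + ∑ j ∈ Finset.range d, b j) (∑ j ∈ Finset.range d, b j)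
    have h2 := norm_sum_le (Finset.range d) b
    rw [add_sub_cancel_right] at h1
    linarith
  | succ r ih =>
    have hLc : (L : ℂ) ≠ 0 := by exact_mod_cast hL.ne'
    refine (ih (fun j => b j * ((L : ℂ)⁻¹ * ∑ i ∈ Finset.range L, η j ^ i)) fun m hm => ?_).trans ?_
    · have e : b₀ + ∑ j ∈ Finset.range d, b j * ((L : ℂ)⁻¹ * ∑ i ∈ Finset.range L, η j ^ i) * η j ^ m
          = (L : ℂ)⁻¹ * ∑ i ∈ Finset.range L,
            (b₀ + ∑ j ∈ Finset.range d, b j * η j ^ (m + i)) := by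
        rw [Finset.sum_add_distrib, Finset.sum_const, Finset.card_range, nsmul_eq_mul, mul_add,
          inv_mul_cancel_left₀ hLc, Finset.sum_comm, Finset.mul_sum]
        congr 1
        refine Finset.sum_congr rfl fun j _ => ?_
        simp only [Finset.mul_sum, Finset.sum_mul]
        refine Finset.sum_congr rfl fun i _ => ?_
        rw [pow_add]; ring
      rw [e, norm_mul, norm_inv, Complex.norm_natCast, inv_mul_le_iff₀ hL']
      refine (norm_sum_le _ _).trans ?_
      refine (Finset.sum_le_card_nsmul _ _ M fun i hi => hM _ ?_).trans (by simp)
      have := Finset.mem_range.1 hi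
      rw [add_mul, one_mul]
      omega
    · refine add_le_add le_rfl (Finset.sum_le_sum fun j hj => ?_)
      rw [norm_mul, norm_mul, norm_inv, Complex.norm_natCast, pow_succ']
      have hρ := hη j (Finset.mem_range.1 hj)
      have hρ0 : 0 ≤ ρ := by
        have := (norm_nonneg _).trans hρ
        exact nonneg_of_mul_nonneg_right this hL'
      rw [← mul_assoc _ ρ]
      refine mul_le_mul_of_nonneg_right ?_ (by positivity)
      refine mul_le_mul_of_nonneg_left ?_ (norm_nonneg _)
      rwa [inv_mul_le_iff₀ hL']

theorem norm_geom_sum_le {η : ℂ} (hη : ‖η‖ = 1) {g : ℝ} (hg : 0 < g) (h : g ≤ ‖1 - η‖) (L : ℕ) :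
    ‖∑ i ∈ Finset.range L, η ^ i‖ ≤ 2 / g := by
  have hne : ‖1 - η‖ ≠ 0 := (hg.trans_le h).ne'
  have h1 := mul_neg_geom_sum η L
  have h2 : ‖1 - η‖ * ‖∑ i ∈ Finset.range L, η ^ i‖ ≤ 2 := by
    rw [← norm_mul, h1]
    refine (norm_sub_le _ _).trans ?_
    rw [norm_pow, hη]; norm_num
  rw [le_div_iff₀ hg, mul_comm]
  exact (mul_le_mul_of_nonneg_right h (norm_nonneg _)).trans h2

open Polynomial in
/-- With `w = e^{2πiω}` and `ζ = e^{2πiθ}`, the polynomial in `w` that equals `w ^ k` times the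
Dirichlet solution of the almost Mathieu equation at site `k`. -/
noncomputable def amoPoly (lam : ℝ) (ζ z : ℂ) : ℕ → ℂ[X]
  | 0 => 1
  | 1 => C z * X - C (lam / 2 : ℂ) * X ^ 2 - C (lam / 2 : ℂ)
  | k + 2 => C z * (X * amoPoly lam ζ z (k + 1))
      - C (lam / 2 * ζ ^ (k + 1) : ℂ) * (X ^ 2 * amoPoly lam ζ z (k + 1))
      - C (lam / 2 * ζ⁻¹ ^ (k + 1) : ℂ) * amoPoly lam ζ z (k + 1) - X ^ 2 * amoPoly lam ζ z k

/-- The point `e^{2πix}` of the unit circle. -/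
noncomputable def circlePt (x : ℝ) : ℂ := Complex.exp ((2 * Real.pi * x : ℝ) * Complex.I)

theorem norm_circlePt (x : ℝ) : ‖circlePt x‖ = 1 := Complex.norm_exp_ofReal_mul_I _

theorem circlePt_ne_zero (x : ℝ) : circlePt x ≠ 0 := Complex.exp_ne_zero _

theorem circlePt_add (x y : ℝ) : circlePt (x + y) = circlePt x * circlePt y := by
  rw [circlePt, circlePt, circlePt, ← Complex.exp_add]
  congr 1; push_cast; ring

theorem circlePt_nat_mul (n : ℕ) (x : ℝ) : circlePt (n * x) = circlePt x ^ n := by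
  rw [circlePt, circlePt, ← Complex.exp_nat_mul]
  congr 1; push_cast; ring

theorem circlePt_mul_amoPotential (lam θ ω : ℝ) (k : ℕ) :
    circlePt ω * (amoPotential lam θ ω k : ℂ)
      = lam / 2 * circlePt θ ^ k * circlePt ω ^ 2 + lam / 2 * (circlePt θ)⁻¹ ^ k := by
  have h0 := circlePt_ne_zero ω
  have h1 := circlePt_ne_zero θ
  have e : ((Real.cos (2 * Real.pi * (((k : ℕ) : ℤ) * θ + ω)) : ℝ) : ℂ)
      = (circlePt ω * circlePt θ ^ k + (circlePt ω * circlePt θ ^ k)⁻¹) / 2 := by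
    rw [← circlePt_nat_mul, ← circlePt_add, circlePt, ← Complex.exp_neg, Complex.ofReal_cos,
      Complex.cos, add_comm ω]
    congr 2
    push_cast
    congr 1
    ring_nf
  rw [amoPotential, Complex.ofReal_mul, e, mul_inv, ← inv_pow]
  field_simp

/-- The extra factor `w ^ k` turns the Laurent polynomial in `w = e^{2πiω}` into a polynomial. -/
theorem eval_amoPoly (lam θ ω : ℝ) (z : ℂ) (k : ℕ) :
    (amoPoly lam (circlePt θ) z k).eval (circlePt ω)
      = circlePt ω ^ k * dirichletSol (fun j => amoPotential lam θ ω j) z k := by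
  induction k using Nat.twoStepInduction with
  | zero => simp [amoPoly, dirichletSol]
  | one =>
    have := circlePt_mul_amoPotential lam θ ω 0
    simp [amoPoly, dirichletSol, mul_sub] at *
    rw [this]; ring
  | more k ih1 ih2 =>
    have := circlePt_mul_amoPotential lam θ ω (k + 1)
    rw [amoPoly, dirichletSol]
    simp only [Polynomial.eval_sub, Polynomial.eval_mul, Polynomial.eval_C, Polynomial.eval_X,
      Polynomial.eval_pow, ih1, ih2]
    linear_combination circlePt ω ^ (k + 1) *
      dirichletSol (fun j => amoPotential lam θ ω j) z (k + 1) * this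

theorem natDegree_amoPoly_le (lam : ℝ) (ζ z : ℂ) (k : ℕ) :
    (amoPoly lam ζ z k).natDegree ≤ 2 * k := by
  induction k using Nat.twoStepInduction with
  | zero => simp [amoPoly]
  | one => rw [amoPoly]; compute_degree
  | more k ih1 ih2 =>
    rw [Polynomial.natDegree_le_iff_coeff_eq_zero] at *
    intro N hN
    obtain ⟨N, rfl⟩ : ∃ M, N = M + 2 := ⟨N - 2, by omega⟩
    rw [amoPoly]
    simp only [Polynomial.coeff_sub, Polynomial.coeff_C_mul, Polynomial.coeff_X_pow_mul]
    rw [show N + 2 = N + 1 + 1 from rfl, Polynomial.coeff_X_mul, ih2 _ (by omega),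
      ih2 _ (by omega), ih2 _ (by omega), ih1 _ (by omega)]
    simp

theorem norm_coeff_amoPoly_top {lam : ℝ} (hl : 0 ≤ lam) {ζ : ℂ} (hζ : ‖ζ‖ = 1) (z : ℂ) (k : ℕ) :
    ‖(amoPoly lam ζ z k).coeff (2 * k)‖ = (lam / 2) ^ k := by
  have hd : ∀ k N, 2 * k < N → (amoPoly lam ζ z k).coeff N = 0 := fun k N hN =>
    Polynomial.coeff_eq_zero_of_natDegree_lt ((natDegree_amoPoly_le lam ζ z k).trans_lt hN)
  induction k using Nat.twoStepInduction with
  | zero => simp [amoPoly]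
  | one =>
    simp [amoPoly, abs_of_nonneg hl]
  | more k ih1 ih2 =>
    rw [amoPoly]
    simp only [Polynomial.coeff_sub, Polynomial.coeff_C_mul]
    rw [show 2 * (k + 2) = 2 * (k + 1) + 2 by ring, Polynomial.coeff_X_pow_mul,
      Polynomial.coeff_X_pow_mul, show 2 * (k + 1) + 2 = 2 * (k + 1) + 1 + 1 from rfl,
      Polynomial.coeff_X_mul, hd (k + 1) (2 * (k + 1) + 1) (by omega),
      hd (k + 1) (2 * (k + 1) + 1 + 1) (by omega), hd k (2 * (k + 1)) (by omega)]
    simp only [mul_zero, zero_sub, sub_zero, norm_neg, norm_mul, ih2, norm_pow, hζ, one_pow]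
    simp [abs_of_nonneg hl]
    ring

theorem norm_coeff_amoPoly_le {lam : ℝ} (hl : 0 ≤ lam) {ζ : ℂ} (hζ : ‖ζ‖ = 1) (z : ℂ) {K : ℝ}
    (hK : ‖z‖ + lam + 1 ≤ K) (k j : ℕ) : ‖(amoPoly lam ζ z k).coeff j‖ ≤ K ^ k := by
  have hK1 : 1 ≤ K := by linarith [norm_nonneg z]
  have hX1 : ∀ (p : Polynomial ℂ) (c : ℝ), 0 ≤ c → (∀ i, ‖p.coeff i‖ ≤ c) →
      ∀ i, ‖(Polynomial.X * p).coeff i‖ ≤ c := by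
    intro p c hc h i
    cases i with
    | zero => simpa using hc
    | succ i => rw [Polynomial.coeff_X_mul]; exact h i
  have hX2 : ∀ (p : Polynomial ℂ) (c : ℝ), 0 ≤ c → (∀ i, ‖p.coeff i‖ ≤ c) →
      ∀ i, ‖(Polynomial.X ^ 2 * p).coeff i‖ ≤ c := by
    intro p c hc h i
    rw [pow_two, mul_assoc]
    exact hX1 _ c hc (hX1 _ c hc h) i
  have hl2 : ‖(lam / 2 : ℂ)‖ = lam / 2 := by simp [abs_of_nonneg hl]
  revert j
  induction k using Nat.twoStepInduction with
  | zero =>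
    intro j
    rw [amoPoly, Polynomial.coeff_one, pow_zero]
    split_ifs <;> simp
  | one =>
    intro j
    rw [amoPoly, pow_one]
    have h1 : ‖(Polynomial.C z * Polynomial.X : Polynomial ℂ).coeff j‖ ≤ ‖z‖ := by
      rw [Polynomial.coeff_C_mul, Polynomial.coeff_X]; split_ifs <;> simp
    have h2 : ‖(Polynomial.C (lam / 2 : ℂ) * Polynomial.X ^ 2 : Polynomial ℂ).coeff j‖
        ≤ lam / 2 := by
      rw [Polynomial.coeff_C_mul, Polynomial.coeff_X_pow]; split_ifs
      · rw [mul_one, hl2]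
      · simpa using div_nonneg hl zero_le_two
    have h3 : ‖(Polynomial.C (lam / 2 : ℂ)).coeff j‖ ≤ lam / 2 := by
      rw [Polynomial.coeff_C]; split_ifs
      · rw [hl2]
      · simpa using div_nonneg hl zero_le_two
    rw [Polynomial.coeff_sub, Polynomial.coeff_sub]
    refine (norm_sub_le _ _).trans ?_
    have := norm_sub_le ((Polynomial.C z * Polynomial.X : Polynomial ℂ).coeff j)
      ((Polynomial.C (lam / 2 : ℂ) * Polynomial.X ^ 2 : Polynomial ℂ).coeff j)
    linarith
  | more k ih1 ih2 =>
    intro j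
    rw [amoPoly]
    simp only [Polynomial.coeff_sub, Polynomial.coeff_C_mul]
    have a1 := mul_le_mul_of_nonneg_left (hX1 _ _ (by positivity) ih2 j) (norm_nonneg z)
    have a2 := mul_le_mul_of_nonneg_left (hX2 _ _ (by positivity) ih2 j)
      (show 0 ≤ lam / 2 by positivity)
    have a3 := mul_le_mul_of_nonneg_left (ih2 j) (show 0 ≤ lam / 2 by positivity)
    have a4 := hX2 _ _ (by positivity) ih1 j
    have hmono : K ^ k ≤ K ^ (k + 1) := pow_le_pow_right₀ hK1 (by omega)
    refine (norm_sub_le _ _).trans ((add_le_add ((norm_sub_le _ _).trans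
      (add_le_add (norm_sub_le _ _) le_rfl)) le_rfl).trans ?_)
    simp only [norm_mul, hl2, norm_pow, norm_inv, hζ, inv_one, one_pow, mul_one]
    have : (‖z‖ + lam + 1) * K ^ (k + 1) ≤ K ^ (k + 2) := by
      rw [show k + 2 = (k + 1) + 1 from rfl, pow_succ' K (k + 1)]
      gcongr
    linarith

theorem two_mul_div_four_pow_le (k : ℕ) : (2 * k : ℝ) / 4 ^ k ≤ 1 / 2 := by
  rw [div_le_div_iff₀ (by positivity) (by norm_num)]
  have : 4 * k ≤ 4 ^ k := by
    induction k with
    | zero => simp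
    | succ k ih => rw [pow_succ]; rcases k with _ | k <;> omega
  have h : ((4 * k : ℕ) : ℝ) ≤ ((4 ^ k : ℕ) : ℝ) := by exact_mod_cast this
  push_cast at h
  linarith

/-- Among the first `k * L` starting points of the orbit there is one for which the Dirichlet
solution at site `k` is at least half the norm of its extreme Fourier coefficient, as soon as `L`
is large compared with the inverse gap of the first `2 k` multiples of `θ`. -/
theorem exists_le_norm_dirichletSol {lam : ℝ} (hl : 2 < lam) (θ ω : ℝ) {z : ℂ} {K : ℝ}
    (hK : ‖z‖ + lam + 1 ≤ K) {k : ℕ} (hk : 0 < k) {g : ℝ} (hg : 0 < g)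
    (hgap : ∀ j : ℕ, 1 ≤ j → j ≤ 2 * k → g ≤ ‖1 - circlePt θ ^ j‖) {L : ℕ}
    (hL : 8 * K / g ≤ L) :
    ∃ m ≤ k * L, (lam / 2) ^ k / 2 ≤
      ‖dirichletSol (fun j => amoPotential lam θ (ω + m * θ) j) z k‖ := by
  have hK1 : 1 ≤ K := by linarith [norm_nonneg z]
  have hLpos : 0 < L := by
    have : (0 : ℝ) < L := lt_of_lt_of_le (by positivity) hL
    exact_mod_cast this
  by_contra! hcon
  set ζ := circlePt θ with hζ
  have hζ1 : ‖ζ‖ = 1 := norm_circlePt θ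
  have hζ0 : ζ ≠ 0 := circlePt_ne_zero θ
  set w := circlePt ω with hw
  have hw1 : ‖w‖ = 1 := norm_circlePt ω
  set p := amoPoly lam ζ z k with hp
  have hη1 : ∀ j : ℕ, ‖ζ ^ j * ζ⁻¹ ^ (2 * k)‖ = 1 := fun j => by simp [hζ1]
  have hη : ∀ j < 2 * k, ‖∑ i ∈ Finset.range L, (ζ ^ j * ζ⁻¹ ^ (2 * k)) ^ i‖
      ≤ L * (1 / (4 * K)) := by
    intro j hj
    refine (norm_geom_sum_le (hη1 j) hg ?_ L).trans ?_
    · have h1 := hgap (2 * k - j) (by omega) (by omega)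
      have h2 : ‖1 - ζ ^ j * ζ⁻¹ ^ (2 * k)‖ = ‖1 - ζ ^ (2 * k - j)‖ := by
        have : (1 - ζ ^ j * ζ⁻¹ ^ (2 * k)) * ζ ^ (2 * k - j) = -(1 - ζ ^ (2 * k - j)) := by
          have h3 : ζ ^ j * ζ ^ (2 * k - j) = ζ ^ (2 * k) := by
            rw [← pow_add]; congr 1; omega
          have h4 : ζ⁻¹ ^ (2 * k) * ζ ^ (2 * k) = 1 := by
            rw [← mul_pow, inv_mul_cancel₀ hζ0, one_pow]
          linear_combination (-ζ⁻¹ ^ (2 * k)) * h3 - h4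
        rw [← norm_neg (1 - ζ ^ (2 * k - j)), ← this, norm_mul, norm_pow, hζ1, one_pow, mul_one]
      rw [h2]; exact h1
    · rw [div_le_iff₀ hg] at *
      rw [mul_one_div, div_mul_eq_mul_div, le_div_iff₀ (by positivity)]
      linarith
  have main := norm_constant_mode_le hLpos hη (p.coeff (2 * k) * w ^ (2 * k)) k
    (fun j => p.coeff j * w ^ j) (M := (lam / 2) ^ k / 2) (fun m hm => by
      refine le_of_eq_of_le ?_ (hcon m hm).le
      have h1 := eval_amoPoly lam θ (ω + m * θ) z k
      rw [circlePt_add, circlePt_nat_mul, ← hζ, ← hw, ← hp,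
        Polynomial.eval_eq_sum_range' (n := 2 * k + 1)
          (Nat.lt_succ_of_le (natDegree_amoPoly_le _ _ _ _))] at h1
      have h2 : ‖dirichletSol (fun j => amoPotential lam θ (ω + m * θ) j) z k‖
          = ‖ζ⁻¹ ^ (2 * k * m) * ((w * ζ ^ m) ^ k *
            dirichletSol (fun j => amoPotential lam θ (ω + m * θ) j) z k)‖ := by
        simp [hζ1, hw1]
      rw [h2, ← h1, Finset.sum_range_succ, mul_add, Finset.mul_sum, add_comm]
      congr 2
      · refine Finset.sum_congr rfl fun j _ => ?_
        rw [mul_pow, mul_pow, ← pow_mul, ← pow_mul, ← pow_mul, mul_comm m j]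
        ring
      · rw [mul_pow, ← pow_mul, mul_comm m (2 * k)]
        have : ζ⁻¹ ^ (2 * k * m) * ζ ^ (2 * k * m) = 1 := by
          rw [← mul_pow, inv_mul_cancel₀ hζ0, one_pow]
        linear_combination (-(p.coeff (2 * k) * w ^ (2 * k))) * this)
  rw [norm_mul, norm_pow, hw1, one_pow, mul_one, hp,
    norm_coeff_amoPoly_top (by linarith) hζ1] at main
  have hsum : ∑ j ∈ Finset.range (2 * k), ‖p.coeff j * w ^ j‖ * (1 / (4 * K)) ^ k ≤ 1 / 2 := by
    refine le_trans ?_ (two_mul_div_four_pow_le k)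
    have : ∀ j ∈ Finset.range (2 * k), ‖p.coeff j * w ^ j‖ * (1 / (4 * K)) ^ k ≤ 1 / 4 ^ k := by
      intro j _
      rw [norm_mul, norm_pow, hw1, one_pow, mul_one]
      calc _ ≤ K ^ k * (1 / (4 * K)) ^ k := by
            gcongr
            exact norm_coeff_amoPoly_le (by linarith) hζ1 z hK k j
        _ = 1 / 4 ^ k := by
            rw [← mul_pow, ← one_div_pow]
            congr 1
            field_simp
    refine (Finset.sum_le_card_nsmul _ _ _ this).trans_eq ?_
    simp [div_eq_mul_inv]
  have hgt : 1 < (lam / 2) ^ k := one_lt_pow₀ (by linarith) hk.ne'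
  linarith

/-! ### Small divisors and continued fractions -/

theorem four_mul_abs_sub_round_le (x : ℝ) : 4 * |x - round x| ≤ ‖1 - circlePt x‖ := by
  have h1 : circlePt x = circlePt (x - round x) := by
    have : circlePt (round x : ℝ) = 1 := by
      rw [circlePt, Complex.exp_eq_one_iff]
      exact ⟨round x, by push_cast; ring⟩
    conv_lhs => rw [← sub_add_cancel x (round x : ℝ), circlePt_add, this, mul_one]
  set y := x - round x with hy
  have hy2 : |y| ≤ 1 / 2 := abs_sub_round x
  have hpi := Real.pi_pos
  rw [h1, norm_sub_rev, circlePt, mul_comm _ Complex.I, Complex.norm_exp_I_mul_ofReal_sub_one]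
  rw [show 2 * Real.pi * y / 2 = Real.pi * y by ring, Real.norm_eq_abs, abs_mul, abs_two]
  have h2 := Real.mul_abs_le_abs_sin (x := Real.pi * y) (by
    rw [abs_mul, abs_of_pos hpi]; nlinarith)
  rw [abs_mul, abs_of_pos hpi, ← mul_assoc, div_mul_cancel₀ _ hpi.ne'] at h2
  linarith

/-- A good rational approximation of denominator `q` keeps the multiples `j θ`, `1 ≤ j ≤ q / 2`,
away from the integers. -/
theorem two_div_le_norm_one_sub_circlePt_pow {θ : ℝ} {P : ℤ} {q : ℕ} (hq : 0 < q)
    (hcop : IsCoprime P (q : ℤ)) (happ : |θ - P / q| ≤ 1 / (q : ℝ) ^ 2) {j : ℕ} (hj : 1 ≤ j)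
    (hjq : 2 * j ≤ q) : 2 / (q : ℝ) ≤ ‖1 - circlePt θ ^ j‖ := by
  rw [← circlePt_nat_mul]
  refine le_trans ?_ (four_mul_abs_sub_round_le _)
  set p := round ((j : ℝ) * θ)
  have hq' : (0 : ℝ) < q := by exact_mod_cast hq
  have hne : (j : ℤ) * P - p * q ≠ 0 := by
    intro h0
    have hdvd : (q : ℤ) ∣ j * P := ⟨p, by linarith⟩
    have h1 : (q : ℤ) ∣ j := (hcop.symm).dvd_of_dvd_mul_right hdvd
    have := Int.le_of_dvd (by exact_mod_cast hj) h1
    omega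
  have h1 : (1 : ℝ) ≤ |(j : ℝ) * P - p * q| := by
    have := Int.one_le_abs hne
    exact_mod_cast this
  have h2 : |(j : ℝ) * P - p * q| ≤ q * |j * θ - p| + q * (j * |θ - P / q|) := by
    have e : (j : ℝ) * P - p * q = q * (j * θ - p) - q * (j * (θ - P / q)) := by
      field_simp; ring
    rw [e]
    refine (abs_sub _ _).trans_eq ?_
    rw [abs_mul, abs_mul, abs_mul, abs_of_pos hq', Nat.abs_cast]
  have h3 : (q : ℝ) * (j * |θ - P / q|) ≤ 1 / 2 := by
    have hjq' : 2 * (j : ℝ) ≤ q := by exact_mod_cast hjq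
    calc (q : ℝ) * (j * |θ - P / q|) ≤ q * (j * (1 / (q : ℝ) ^ 2)) := by gcongr
      _ = j / q := by field_simp
      _ ≤ 1 / 2 := by rw [div_le_div_iff₀ hq' (by norm_num)]; linarith
  rw [div_le_iff₀ hq']
  nlinarith

theorem not_terminatedAt_of_irrational {θ : ℝ} (hθ : Irrational θ) (n : ℕ) :
    ¬ (GenContFract.of θ).TerminatedAt n := fun h =>
  hθ (by
    obtain ⟨q, hq⟩ := (GenContFract.terminates_iff_rat θ).1 ⟨n, h⟩
    exact ⟨q, hq.symm⟩)

theorem exists_int_contsAux (θ : ℝ) (hθ : Irrational θ) (n : ℕ) :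
    ∃ a b : ℤ, (GenContFract.of θ).contsAux n = ⟨a, b⟩ := by
  induction n using Nat.twoStepInduction with
  | zero => exact ⟨1, 0, by simp⟩
  | one => exact ⟨⌊θ⌋, 1, by simp [GenContFract.of_h_eq_floor]⟩
  | more n ih1 ih2 =>
    obtain ⟨a, b, h1⟩ := ih1
    obtain ⟨c, d, h2⟩ := ih2
    obtain ⟨gp, hgp⟩ : ∃ gp, (GenContFract.of θ).s.get? n = some gp :=
      Option.ne_none_iff_exists'.1 (not_terminatedAt_of_irrational hθ n)
    obtain ⟨ha, z, hb⟩ := GenContFract.of_partNum_eq_one_and_exists_int_partDen_eq hgp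
    refine ⟨z * c + a, z * d + b, ?_⟩
    rw [GenContFract.contsAux_recurrence hgp h1 h2, ha, hb]
    simp

/-- The `k`-th convergent of an irrational number in lowest terms. -/
theorem exists_convergent {θ : ℝ} (hθ : Irrational θ) (k : ℕ) :
    ∃ (P : ℤ) (q : ℕ), cfDenom θ k = q ∧ Nat.fib (k + 1) ≤ q ∧ IsCoprime P (q : ℤ) ∧
      |θ - P / q| ≤ 1 / (q : ℝ) ^ 2 := by
  obtain ⟨a, b, h1⟩ := exists_int_contsAux θ hθ (k + 1)
  obtain ⟨c, d, h2⟩ := exists_int_contsAux θ hθ (k + 1 + 1)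
  have hn1 : (GenContFract.of θ).nums k = a := by
    rw [GenContFract.num_eq_conts_a, GenContFract.nth_cont_eq_succ_nth_contAux, h1]
  have hd1 : (GenContFract.of θ).dens k = b := by
    rw [GenContFract.den_eq_conts_b, GenContFract.nth_cont_eq_succ_nth_contAux, h1]
  have hn2 : (GenContFract.of θ).nums (k + 1) = c := by
    rw [GenContFract.num_eq_conts_a, GenContFract.nth_cont_eq_succ_nth_contAux, h2]
  have hd2 : (GenContFract.of θ).dens (k + 1) = d := by
    rw [GenContFract.den_eq_conts_b, GenContFract.nth_cont_eq_succ_nth_contAux, h2]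
  have hfib := GenContFract.succ_nth_fib_le_of_nth_den (K := ℝ) (v := θ) (n := k)
    (Or.inr (not_terminatedAt_of_irrational hθ _))
  rw [hd1] at hfib
  have hfib' : (Nat.fib (k + 1) : ℤ) ≤ b := by exact_mod_cast hfib
  have hpos : 0 < Nat.fib (k + 1) := Nat.fib_pos.2 (by omega)
  have hb : ((b.toNat : ℕ) : ℤ) = b := Int.toNat_of_nonneg (by omega)
  have hbr : ((b.toNat : ℕ) : ℝ) = b := by exact_mod_cast hb
  have hbpos : (0 : ℝ) < b := by
    have : (0 : ℤ) < b := by omega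
    exact_mod_cast this
  refine ⟨a, b.toNat, by rw [cfDenom, hd1, hbr], by omega, ?_, ?_⟩
  · have hdet := SimpContFract.determinant (s := SimpContFract.of θ) (n := k)
      (not_terminatedAt_of_irrational hθ k)
    change (GenContFract.of θ).nums k * (GenContFract.of θ).dens (k + 1)
      - (GenContFract.of θ).dens k * (GenContFract.of θ).nums (k + 1) = (-1) ^ (k + 1) at hdet
    rw [hn1, hd1, hn2, hd2] at hdet
    have hdet' : a * d - b * c = (-1) ^ (k + 1) := by exact_mod_cast hdet
    rw [hb]
    refine ⟨(-1) ^ (k + 1) * d, -(-1) ^ (k + 1) * c, ?_⟩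
    have hsq : ((-1 : ℤ) ^ (k + 1)) * (-1) ^ (k + 1) = 1 := by
      rw [← mul_pow]; simp
    linear_combination (-1) ^ (k + 1) * hdet' + hsq
  · have := GenContFract.abs_sub_convs_le (v := θ) (not_terminatedAt_of_irrational hθ k)
    rw [GenContFract.conv_eq_num_div_den, hn1, hd1] at this
    rw [hbr]
    refine this.trans ?_
    rw [sq]
    have hmono : (b : ℝ) ≤ (GenContFract.of θ).dens (k + 1) := by
      rw [← hd1]; exact GenContFract.of_den_mono
    gcongr

/-- The first `2 k` multiples of `θ` stay at distance at least `e^{-δk}` from the integers, in the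
chordal metric. -/
def PhaseGap (θ δ : ℝ) (k : ℕ) : Prop :=
  ∀ j : ℕ, 1 ≤ j → j ≤ 2 * k → Real.exp (-δ * k) ≤ ‖1 - circlePt θ ^ j‖

theorem cfDenom_tendsto {θ : ℝ} (hθ : Irrational θ) :
    Filter.Tendsto (cfDenom θ) Filter.atTop Filter.atTop := by
  refine Filter.tendsto_atTop_mono' Filter.atTop (f₁ := fun k : ℕ => ((k : ℝ))) ?_
    tendsto_natCast_atTop_atTop
  filter_upwards [Filter.eventually_ge_atTop 5] with k hk
  obtain ⟨P, q, h1, h2, -⟩ := exists_convergent hθ k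
  rw [h1]
  have h3 : k + 1 ≤ Nat.fib (k + 1) := Nat.le_fib_self (by omega)
  exact_mod_cast (by omega : k ≤ q)

/-- Along the denominators `q` of the convergents, `k = ⌊q / 4⌋` has only polynomially small
divisors. -/
theorem frequently_phaseGap {θ : ℝ} (hθ : Irrational θ) {δ : ℝ} (hδ : 0 < δ) :
    ∃ᶠ k in Filter.atTop, PhaseGap θ δ k := by
  rw [Filter.frequently_atTop]
  intro k₀
  have hexp : Filter.Tendsto (fun x : ℝ => Real.exp (δ * x) / x ^ (1 : ℝ)) Filter.atTop
      Filter.atTop := tendsto_exp_mul_div_rpow_atTop 1 δ hδ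
  have hk : ∀ᶠ k : ℕ in Filter.atTop, 4 ≤ Real.exp (δ * k) / (k : ℝ) ^ (1 : ℝ) :=
    (hexp.comp tendsto_natCast_atTop_atTop).eventually_ge_atTop 4
  obtain ⟨k₁, hk₁⟩ := Filter.eventually_atTop.1 hk
  obtain ⟨i, hi⟩ := ((cfDenom_tendsto hθ).eventually_ge_atTop
    ((4 * (k₀ + k₁ + 1) : ℕ) : ℝ)).exists
  obtain ⟨P, q, h1, h2, hcop, happ⟩ := exists_convergent hθ i
  rw [h1] at hi
  have hq : 4 * (k₀ + k₁ + 1) ≤ q := by exact_mod_cast hi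
  refine ⟨q / 4, by omega, fun j hj hj2 => ?_⟩
  refine le_trans ?_ (two_div_le_norm_one_sub_circlePt_pow (by omega) hcop happ hj (by omega))
  have h3 := hk₁ (q / 4) (by omega)
  have hkpos : (0 : ℝ) < (q / 4 : ℕ) := by exact_mod_cast (by omega : 0 < q / 4)
  have hq4 : (q : ℝ) ≤ 8 * (q / 4 : ℕ) := by exact_mod_cast (by omega : q ≤ 8 * (q / 4))
  have hqpos : (0 : ℝ) < q := by exact_mod_cast (by omega : 0 < q)
  rw [Real.rpow_one, le_div_iff₀ hkpos] at h3
  rw [neg_mul, Real.exp_neg, inv_le_comm₀ (Real.exp_pos _) (by positivity), inv_div]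
  linarith

/-- Under the weak Brjuno condition the small divisors are subexponential at every scale. -/
theorem eventually_phaseGap {θ : ℝ} (hθ : Irrational θ) (hB : WeakBrjuno θ) {δ : ℝ} (hδ : 0 < δ) :
    ∀ᶠ k in Filter.atTop, PhaseGap θ δ k := by
  have hB' := hB.eventually_lt_const (show (0 : ℝ) < δ / 4 by positivity)
  obtain ⟨i₀, hi₀⟩ := Filter.eventually_atTop.1 hB'
  have hd := cfDenom_tendsto hθ
  obtain ⟨P₀, Q₀, hQ₀, -⟩ := exists_convergent hθ i₀
  filter_upwards [Filter.eventually_ge_atTop (Q₀ + 1)] with k hk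
  -- the first denominator beyond `4 k`; it comes after the index `i₀`
  have hex : ∃ i, (4 * k : ℝ) ≤ cfDenom θ i := (hd.eventually_ge_atTop _).exists
  classical
  set i := Nat.find hex with hi
  have hi1 : (4 * k : ℝ) ≤ cfDenom θ i := Nat.find_spec hex
  have hmono : Monotone (cfDenom θ) := monotone_nat_of_le_succ fun n => GenContFract.of_den_mono
  have hi2 : i₀ < i := by
    by_contra! hle
    have h1 := hmono hle
    rw [hQ₀] at h1
    have h2 : ((Q₀ + 1 : ℕ) : ℝ) ≤ k := by exact_mod_cast hk
    push_cast at h2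
    have : (0 : ℝ) ≤ Q₀ := Nat.cast_nonneg _
    linarith
  obtain ⟨i', hi'⟩ : ∃ i', i = i' + 1 := ⟨i - 1, by omega⟩
  have hi3 : cfDenom θ i' < 4 * k := by
    have := Nat.find_min hex (m := i') (by omega)
    push Not at this
    exact this
  have h4 := hi₀ i' (by omega)
  rw [← hi'] at h4
  obtain ⟨P, q, h1, h2, hcop, happ⟩ := exists_convergent hθ i
  obtain ⟨P', q', h1', h2', -⟩ := exists_convergent hθ i'
  rw [h1, h1'] at h4
  rw [h1'] at hi3
  rw [h1] at hi1
  have hq' : (0 : ℝ) < q' := by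
    have : 0 < Nat.fib (i' + 1) := Nat.fib_pos.2 (by omega)
    exact_mod_cast (by omega : 0 < q')
  have hqk : 4 * k ≤ q := by exact_mod_cast hi1
  have hqpos : (0 : ℝ) < q := by exact_mod_cast (by omega : 0 < q)
  intro j hj hj2
  refine le_trans ?_ (two_div_le_norm_one_sub_circlePt_pow (by omega) hcop happ hj (by omega))
  rw [div_lt_iff₀ hq'] at h4
  have h5 : Real.log q ≤ δ * k := by nlinarith
  have h6 : (q : ℝ) ≤ Real.exp (δ * k) := by
    rw [← Real.log_le_iff_le_exp hqpos]; exact h5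
  rw [neg_mul, Real.exp_neg, inv_le_comm₀ (Real.exp_pos _) (by positivity), inv_div]
  linarith

/-! ### Decay of bounded half-line solutions at a localizing time scale -/

/-- At the time scale `T`, every half line carries within distance `T ^ α / 8` of its origin a
Dirichlet solution of size at least `T ^ s`, uniformly in the phase and in the energies `‖z‖ ≤ R`. -/
def LocalizingScale (lam θ R α : ℝ) (s : ℕ) (T : ℝ) : Prop :=
  ∀ (ω : ℝ) (z : ℂ), ‖z‖ ≤ R → ∃ m k : ℕ, (m + k + 2 : ℝ) ≤ T ^ α / 8 ∧
    T ^ s ≤ ‖dirichletSol (fun j => amoPotential lam θ ω ((m + 1 + j : ℕ) : ℤ)) z k‖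

theorem amoPotential_shift (lam θ ω : ℝ) (m j : ℕ) :
    amoPotential lam θ ω ((m + 1 + j : ℕ) : ℤ) = amoPotential lam θ (ω + θ + m * θ) j := by
  rw [amoPotential, amoPotential]
  congr 3
  push_cast
  ring

/-- A phase gap at scale `k` makes all times `T` with `log T ≈ c k` localizing. -/
theorem exists_scale {lam : ℝ} (hl : 2 < lam) (θ : ℝ) {R α : ℝ} (hR : 0 ≤ R) (hα : 0 < α)
    (s : ℕ) : ∃ c > 0, ∃ δ > 0, ∃ k₀ : ℕ, ∀ k ≥ k₀, PhaseGap θ δ k →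
      ∀ T, Real.exp (c * (k - 1)) ≤ T → T ≤ Real.exp (c * k) → LocalizingScale lam θ R α s T := by
  set c₀ := Real.log (lam / 2) with hc₀
  have hc₀pos : 0 < c₀ := Real.log_pos (by linarith)
  set c := c₀ / (2 * (s + 1)) with hc
  have hcpos : 0 < c := by positivity
  set K := R + lam + 1 with hK
  have hKpos : 0 < K := by positivity
  set A := 8 * (8 * K + 5) * Real.exp (c * α) with hA
  have hexp : Filter.Tendsto (fun x : ℝ => Real.exp (c * α / 2 * x) / x ^ (1 : ℝ)) Filter.atTop
      Filter.atTop := tendsto_exp_mul_div_rpow_atTop 1 _ (by positivity)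
  have hk1 : ∀ᶠ k : ℕ in Filter.atTop, A ≤ Real.exp (c * α / 2 * k) / (k : ℝ) ^ (1 : ℝ) :=
    (hexp.comp tendsto_natCast_atTop_atTop).eventually_ge_atTop A
  have hk2 : ∀ᶠ k : ℕ in Filter.atTop, 2 * Real.log 2 / c₀ ≤ k :=
    tendsto_natCast_atTop_atTop.eventually_ge_atTop _
  obtain ⟨k₀, hk₀⟩ := Filter.eventually_atTop.1 (hk1.and (hk2.and (Filter.eventually_ge_atTop 1)))
  refine ⟨c, hcpos, c * α / 2, by positivity, k₀, fun k hk hgap T hT1 hT2 ω z hz => ?_⟩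
  obtain ⟨h1, h2, h3⟩ := hk₀ k hk
  have hkpos : (0 : ℝ) < k := by exact_mod_cast h3
  have hk1' : (1 : ℝ) ≤ k := by exact_mod_cast h3
  have hT0 : 0 < T := (Real.exp_pos _).trans_le hT1
  set g := Real.exp (-(c * α / 2) * k) with hg
  have hg1 : 1 / g = Real.exp (c * α / 2 * k) := by
    rw [hg, neg_mul, Real.exp_neg, one_div, inv_inv]
  set L := ⌈8 * K / g⌉₊ with hL
  obtain ⟨m, hm, hu⟩ := exists_le_norm_dirichletSol hl θ (ω + θ) (K := K) (z := z)
    (by linarith) h3 (Real.exp_pos _) hgap (Nat.le_ceil (8 * K / g))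
  refine ⟨m, k, ?_, ?_⟩
  · have hL1 : (L : ℝ) ≤ 8 * K * Real.exp (c * α / 2 * k) + 1 := by
      rw [← hg1, mul_one_div]
      exact (Nat.ceil_lt_add_one (by positivity)).le
    have hm' : (m : ℝ) ≤ k * L := by exact_mod_cast hm
    have he1 : 1 ≤ Real.exp (c * α / 2 * k) := Real.one_le_exp (by positivity)
    rw [Real.rpow_one, le_div_iff₀ hkpos] at h1
    have hTα : Real.exp (c * α / 2 * k) ^ 2 = Real.exp (c * α) * Real.exp (c * (k - 1)) ^ α := by
      rw [← Real.exp_nat_mul, ← Real.exp_mul, ← Real.exp_add]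
      congr 1
      push_cast
      ring
    have hTα' : Real.exp (c * (k - 1)) ^ α ≤ T ^ α := by gcongr
    set e := Real.exp (c * α / 2 * k) with he
    have hlow : (m + k + 2 : ℝ) ≤ (8 * K + 5) * (k * e) := by nlinarith
    have h4 : A * k * e ≤ Real.exp (c * α) * T ^ α := by
      calc A * k * e ≤ e * e := by gcongr
        _ = e ^ 2 := by ring
        _ ≤ _ := by rw [hTα]; gcongr
    have h5 : 8 * (8 * K + 5) * (k * e) ≤ T ^ α := by
      refine le_of_mul_le_mul_left ?_ (Real.exp_pos (c * α))
      calc _ = A * k * e := by rw [hA]; ring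
        _ ≤ _ := h4
    linarith
  · simp only [amoPotential_shift]
    refine le_trans ?_ hu
    have hlam : (lam / 2) ^ k = Real.exp (c₀ * k) := by
      rw [mul_comm, Real.exp_nat_mul, hc₀, Real.exp_log (by linarith)]
    rw [hlam]
    have h4 : T ^ s ≤ Real.exp (c₀ * k / 2) := by
      calc T ^ s ≤ Real.exp (c * k) ^ s := by gcongr
        _ = Real.exp (s * (c * k)) := by rw [Real.exp_nat_mul]
        _ ≤ _ := by
          apply Real.exp_le_exp.2
          have : (s : ℝ) * c ≤ c₀ / 2 := by
            rw [hc, mul_div_assoc', div_le_div_iff₀ (by positivity) (by norm_num)]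
            nlinarith
          nlinarith
    have h5 : 2 ≤ Real.exp (c₀ * k / 2) := by
      rw [div_le_iff₀ hc₀pos] at h2
      rw [← Real.log_le_iff_le_exp (by norm_num)]
      linarith
    have h6 : Real.exp (c₀ * k) = Real.exp (c₀ * k / 2) * Real.exp (c₀ * k / 2) := by
      rw [← Real.exp_add]; congr 1; ring
    nlinarith

theorem frequently_localizingScale {lam θ : ℝ} (hl : 2 < lam) (hθ : Irrational θ) {R α : ℝ}
    (hR : 0 ≤ R) (hα : 0 < α) (s : ℕ) :
    ∃ᶠ T in Filter.atTop, LocalizingScale lam θ R α s T := by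
  obtain ⟨c, hc, δ, hδ, k₀, h⟩ := exists_scale hl θ hR hα s
  rw [Filter.frequently_atTop]
  intro T₀
  have h1 : Filter.Tendsto (fun k : ℕ => Real.exp (c * k)) Filter.atTop Filter.atTop :=
    Real.tendsto_exp_atTop.comp (tendsto_natCast_atTop_atTop.const_mul_atTop hc)
  obtain ⟨k, hgap, hT, hk⟩ := ((frequently_phaseGap hθ hδ).and_eventually
    ((h1.eventually_ge_atTop T₀).and (Filter.eventually_ge_atTop k₀))).exists
  refine ⟨_, hT, h k hk hgap _ ?_ le_rfl⟩
  apply Real.exp_le_exp.2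
  nlinarith

theorem eventually_localizingScale {lam θ : ℝ} (hl : 2 < lam) (hθ : Irrational θ)
    (hB : WeakBrjuno θ) {R α : ℝ} (hR : 0 ≤ R) (hα : 0 < α) (s : ℕ) :
    ∀ᶠ T in Filter.atTop, LocalizingScale lam θ R α s T := by
  obtain ⟨c, hc, δ, hδ, k₀, h⟩ := exists_scale hl θ hR hα s
  have h1 : Filter.Tendsto (fun T : ℝ => ⌈Real.log T / c⌉₊) Filter.atTop Filter.atTop :=
    tendsto_nat_ceil_atTop.comp (Real.tendsto_log_atTop.atTop_div_const hc)
  filter_upwards [h1.eventually (eventually_phaseGap hθ hB hδ), h1.eventually_ge_atTop k₀,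
    Filter.eventually_gt_atTop 1] with T hgap hk hT
  have hlog : 0 ≤ Real.log T / c := div_nonneg (Real.log_nonneg hT.le) hc.le
  refine h _ hk hgap T ?_ ?_
  · rw [← Real.le_log_iff_exp_le (by linarith)]
    have := Nat.ceil_lt_add_one hlog
    rw [mul_comm, ← le_div_iff₀ hc]
    linarith
  · rw [← Real.log_le_iff_le_exp (by linarith), mul_comm, ← div_le_iff₀ hc]
    exact Nat.le_ceil _

theorem abs_amoPotential_le {lam : ℝ} (hl : 0 ≤ lam) (θ ω : ℝ) (n : ℤ) :
    |amoPotential lam θ ω n| ≤ lam := by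
  rw [amoPotential, abs_mul, abs_of_nonneg hl]
  exact mul_le_of_le_one_right hl (Real.abs_cos_le_one _)

/-- Energies inside the bulk: the rapid growth of a Dirichlet solution near the origin and the
exponential decay at rate `1 / T` combine to a power law with a small prefactor. -/
theorem inner_bound {lam θ α T : ℝ} (hT : 1 ≤ T) {s q : ℕ} (hq : 0 < q)
    (hloc : LocalizingScale lam θ (lam + 4) α s T) {ω E : ℝ} (hE : |E| ≤ lam + 3) {φ : ℕ → ℂ}
    (hφ : IsHalfLineSol (fun j => amoPotential lam θ ω j) (E + (1 / (2 * T) : ℝ) * Complex.I) φ)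
    (hb : ∀ n, ‖φ n‖ ≤ 2 * T) {j : ℕ} (hj : T ^ α / 2 ≤ j) :
    ‖φ j‖ ^ 2 ≤ 16 * (4 * q) ^ q * T ^ (4 + q) / T ^ s / (1 + j) ^ q := by
  have hT0 : 0 < T := by linarith
  have hq' : (0 : ℝ) < q := by exact_mod_cast hq
  set z : ℂ := E + (1 / (2 * T) : ℝ) * Complex.I with hz
  have hzim : z.im = 1 / (2 * T) := by rw [hz]; simp
  have hznorm : ‖z‖ ≤ lam + 4 := by
    refine (norm_add_le _ _).trans ?_
    rw [norm_mul, Complex.norm_real, Complex.norm_real, Complex.norm_I, mul_one,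
      Real.norm_eq_abs, Real.norm_eq_abs, abs_of_pos (show 0 < 1 / (2 * T) by positivity)]
    have : 1 / (2 * T) ≤ 1 := by rw [div_le_one (by positivity)]; linarith
    linarith
  obtain ⟨m, k, h1, h2⟩ := hloc ω z hznorm
  set i := j / 4 with hi
  have h3 : m + k + 2 + 2 * i ≤ j := by
    have : (4 * (m + k + 2 : ℕ) : ℝ) ≤ j := by push_cast; linarith
    have : 4 * (m + k + 2) ≤ j := by exact_mod_cast this
    omega
  have h4 := hφ.sq_norm_le (by rw [hzim]; positivity) hb (pow_pos hT0 s) h2 h3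
  rw [hzim] at h4
  have e1 : (2 * T) ^ 2 / ((1 / (2 * T)) ^ 2 * T ^ s) = 16 * T ^ 4 / T ^ s := by
    field_simp; norm_num
  rw [e1, show 1 + 2 * (1 / (2 * T)) = 1 + 1 / T by field_simp] at h4
  set l := i / q with hldef
  have hl1 : (1 + j : ℝ) ≤ 4 * q * (1 + l) := by
    have a1 : j < 4 * (i + 1) := by omega
    have a2 : i < q * (l + 1) := Nat.lt_mul_div_succ i hq
    have : 1 + j ≤ 4 * q * (1 + l) := by nlinarith
    exact_mod_cast this
  have h5 : ((1 + l) / T : ℝ) ^ q ≤ (1 + 1 / T) ^ i := by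
    have b1 : (1 + l * (1 / T) : ℝ) ≤ (1 + 1 / T) ^ l :=
      one_add_mul_le_pow (by have : 0 < 1 / T := by positivity
                             linarith) l
    have b2 : ((1 + l) / T : ℝ) ≤ (1 + 1 / T) ^ l := by
      refine le_trans ?_ b1
      rw [add_div]
      have : 1 / T ≤ 1 := by rw [div_le_one hT0]; exact hT
      rw [mul_one_div]
      linarith
    calc ((1 + l) / T : ℝ) ^ q ≤ ((1 + 1 / T) ^ l) ^ q := by gcongr
      _ = (1 + 1 / T) ^ (l * q) := by rw [pow_mul]
      _ ≤ (1 + 1 / T) ^ i := by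
        refine pow_le_pow_right₀ ?_ (Nat.div_mul_le_self i q)
        have : 0 < 1 / T := by positivity
        linarith
  have h6 : ((1 + j) / (4 * q * T) : ℝ) ^ q ≤ (1 + 1 / T) ^ i := by
    refine le_trans ?_ h5
    gcongr ?_ ^ q
    rw [div_le_div_iff₀ (by positivity) hT0]
    nlinarith
  have h7 : ‖φ j‖ ^ 2 * ((1 + j) / (4 * q * T) : ℝ) ^ q ≤ 16 * T ^ 4 / T ^ s :=
    (mul_le_mul_of_nonneg_left h6 (by positivity)).trans h4
  rw [div_pow, mul_div_assoc', div_le_iff₀ (by positivity)] at h7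
  rw [le_div_iff₀ (by positivity)]
  refine h7.trans_eq ?_
  rw [mul_pow, pow_add]
  ring

/-- Energies outside the bulk: Dirichlet solutions grow geometrically in every phase. -/
theorem outer_bound {lam θ T : ℝ} (hl : 2 < lam) (hT : 1 ≤ T) {ω E : ℝ} (hE : lam + 3 ≤ |E|)
    {φ : ℕ → ℂ}
    (hφ : IsHalfLineSol (fun j => amoPotential lam θ ω j) (E + (1 / (2 * T) : ℝ) * Complex.I) φ)
    (hb : ∀ n, ‖φ n‖ ≤ 2 * T) (j : ℕ) :
    (1 + E ^ 2) * ‖φ (j + 3)‖ ≤ 4 * (1 + (lam + 2) ^ 2) * T ^ 2 / 2 ^ j := by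
  have hT0 : 0 < T := by linarith
  set z : ℂ := E + (1 / (2 * T) : ℝ) * Complex.I with hz
  have hzim : z.im = 1 / (2 * T) := by rw [hz]; simp
  have hzre : z.re = E := by rw [hz]; simp
  have hznorm : |E| ≤ ‖z‖ := by rw [← hzre]; exact Complex.abs_re_le_norm z
  set x := |E| - lam - 1 with hx
  have hx2 : 2 ≤ x := by linarith
  have h1 := hφ.norm_mul_dirichletSol_le (by rw [hzim]; positivity) hb 0 (j + 2)
  have h2 := pow_le_norm_dirichletSol (V := fun j : ℕ => amoPotential lam θ ω ((0 + 1 + j : ℕ) : ℤ))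
    (fun n => abs_amoPotential_le (by linarith) θ ω _) (z := z) (l := lam) (by linarith) (j + 2)
  have h3 : x ^ (j + 2) ≤ ‖dirichletSol (fun j : ℕ => amoPotential lam θ ω ((0 + 1 + j : ℕ) : ℤ)) z
      (j + 2)‖ := by
    refine le_trans ?_ h2
    exact pow_le_pow_left₀ (by linarith) (by linarith) _
  rw [hzim, show 0 + 1 + (j + 2) = j + 3 by ring] at h1
  have h4 : ‖φ (j + 3)‖ * x ^ (j + 2) ≤ 4 * T ^ 2 := by
    have : 1 / (2 * T) * (‖φ (j + 3)‖ * x ^ (j + 2)) ≤ 2 * T := by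
      refine le_trans ?_ (h1.trans (hb 0))
      gcongr
    rw [one_div, inv_mul_le_iff₀ (by positivity)] at this
    linarith
  have h5 : 1 + E ^ 2 ≤ (1 + (lam + 2) ^ 2) * x ^ 2 := by
    rw [← sq_abs E]
    have : |E| = x + lam + 1 := by rw [hx]; ring
    rw [this]
    have b : x + lam + 1 ≤ (lam + 2) * x := by nlinarith
    have b0 : 0 ≤ x + lam + 1 := by linarith
    nlinarith
  rw [le_div_iff₀ (by positivity)]
  calc (1 + E ^ 2) * ‖φ (j + 3)‖ * 2 ^ j
      ≤ ((1 + (lam + 2) ^ 2) * x ^ 2) * ‖φ (j + 3)‖ * x ^ j := by gcongr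
    _ = (1 + (lam + 2) ^ 2) * (‖φ (j + 3)‖ * x ^ (j + 2)) := by ring
    _ ≤ (1 + (lam + 2) ^ 2) * (4 * T ^ 2) := by gcongr
    _ = _ := by ring

theorem one_add_pow_le_four_pow (r j : ℕ) :
    (1 + j : ℝ) ^ r ≤ r.factorial * 4 * 4 ^ j := by
  have h1 := Real.pow_div_factorial_le_exp (1 + j : ℝ) (by positivity) r
  rw [div_le_iff₀ (by positivity)] at h1
  have h2 : Real.exp (1 + j) ≤ 4 ^ (j + 1) := by
    have : (1 + j : ℝ) = ((j + 1 : ℕ) : ℝ) * 1 := by push_cast; ring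
    rw [this, Real.exp_nat_mul]
    gcongr
    linarith [Real.exp_one_lt_d9]
  calc _ ≤ _ := h1
    _ ≤ 4 ^ (j + 1) * r.factorial := by gcongr
    _ = _ := by ring

/-- Uniform decay in the energy of bounded half-line solutions at a localizing scale. -/
theorem exists_halfLine_bound {lam α : ℝ} (hl : 2 < lam) (hα : 0 < α) (s : ℕ) {q : ℕ}
    (hq : 0 < q) : ∃ C : ℝ, 0 < C ∧ ∀ θ T : ℝ, 1 ≤ T →
      LocalizingScale lam θ (lam + 4) α s T → ∀ (ω E : ℝ) (φ : ℕ → ℂ),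
      IsHalfLineSol (fun j => amoPotential lam θ ω j) (E + (1 / (2 * T) : ℝ) * Complex.I) φ →
      (∀ n, ‖φ n‖ ≤ 2 * T) → ∀ j : ℕ, 3 ≤ j → T ^ α / 2 ≤ j →
      ((1 + E ^ 2) * ‖φ j‖) ^ 2 ≤ C * T ^ (4 + q) / T ^ s / (1 + j) ^ q := by
  -- `(T ^ α) ^ a` dominates `T ^ s`
  obtain ⟨a, ha⟩ : ∃ a : ℕ, (s : ℝ) ≤ α * a := by
    obtain ⟨a, ha⟩ := exists_nat_ge ((s : ℝ) / α)
    exact ⟨a, by rwa [div_le_iff₀' hα] at ha⟩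
  set C₁ := (1 + (lam + 3) ^ 2) ^ 2 * (16 * (4 * q) ^ q) with hC₁
  set D : ℝ := (4 * (1 + (lam + 2) ^ 2)) ^ 2 with hD
  set F : ℝ := ((q + a).factorial : ℝ) * 4 * 64 with hF
  refine ⟨C₁ + D * (F * 2 ^ a), by positivity, ?_⟩
  intro θ T hT hloc ω E φ hφ hb j hj3 hj
  have hT0 : 0 < T := by linarith
  rcases le_total |E| (lam + 3) with hE | hE
  · have h1 := inner_bound hT hq hloc hE hφ hb hj
    have h2 : 1 + E ^ 2 ≤ 1 + (lam + 3) ^ 2 := by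
      rw [← sq_abs E]; gcongr
    calc ((1 + E ^ 2) * ‖φ j‖) ^ 2 = (1 + E ^ 2) ^ 2 * ‖φ j‖ ^ 2 := by ring
      _ ≤ (1 + (lam + 3) ^ 2) ^ 2 * (16 * (4 * q) ^ q * T ^ (4 + q) / T ^ s / (1 + j) ^ q) := by
        gcongr
      _ = C₁ * T ^ (4 + q) / T ^ s / (1 + j) ^ q := by rw [hC₁]; ring
      _ ≤ _ := by
        gcongr
        have : 0 ≤ D * (F * 2 ^ a) := by positivity
        linarith
  · obtain ⟨i, rfl⟩ := Nat.exists_eq_add_of_le' hj3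
    have h1 := outer_bound hl hT hE hφ hb i
    have h2 := one_add_pow_le_four_pow (q + a) (i + 3)
    have h3 : T ^ s ≤ 2 ^ a * (1 + (i + 3 : ℕ) : ℝ) ^ a := by
      rw [← mul_pow]
      calc T ^ s = T ^ (s : ℝ) := by rw [Real.rpow_natCast]
        _ ≤ T ^ (α * a) := Real.rpow_le_rpow_of_exponent_le hT ha
        _ = (T ^ α) ^ a := by rw [Real.rpow_mul hT0.le, Real.rpow_natCast]
        _ ≤ _ := by gcongr; linarith
    calc ((1 + E ^ 2) * ‖φ (i + 3)‖) ^ 2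
        ≤ (4 * (1 + (lam + 2) ^ 2) * T ^ 2 / 2 ^ i) ^ 2 := by gcongr
      _ = D * T ^ 4 / 4 ^ i := by
        rw [div_pow, ← pow_mul, mul_comm i 2, pow_mul, hD]; norm_num; ring
      _ ≤ D * T ^ 4 * (F * 2 ^ a / T ^ s / (1 + (i + 3 : ℕ) : ℝ) ^ q) := by
        rw [div_eq_mul_inv]
        refine mul_le_mul_of_nonneg_left ?_ (by positivity)
        rw [le_div_iff₀ (by positivity), le_div_iff₀ (by positivity), mul_assoc,
          inv_mul_le_iff₀ (by positivity)]
        calc (1 + (i + 3 : ℕ) : ℝ) ^ q * T ^ s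
            ≤ (1 + (i + 3 : ℕ) : ℝ) ^ q * (2 ^ a * (1 + (i + 3 : ℕ) : ℝ) ^ a) := by gcongr
          _ = 2 ^ a * (1 + (i + 3 : ℕ) : ℝ) ^ (q + a) := by rw [pow_add]; ring
          _ ≤ 2 ^ a * ((q + a).factorial * 4 * 4 ^ (i + 3)) := by gcongr
          _ = 4 ^ i * (F * 2 ^ a) := by rw [hF, pow_add]; ring
      _ = D * (F * 2 ^ a) * T ^ 4 / T ^ s / (1 + (i + 3 : ℕ) : ℝ) ^ q := by ring
      _ ≤ _ := by
        gcongr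
        · have : 0 ≤ C₁ := by positivity
          linarith
        · omega

/-! ### The Schrödinger evolution of `δ₁` -/

/-- `ψ n t` is the amplitude at site `n` and time `t` of a normalized solution of
`i ∂ₜ ψ = H ψ` that starts at `δ₁`, with `H` the discrete Schrödinger operator of potential `V`. -/
structure IsEvolution (V : ℤ → ℝ) (ψ : ℤ → ℝ → ℂ) : Prop where
  hasDerivAt : ∀ n t, HasDerivAt (ψ n)
    (-Complex.I * (ψ (n + 1) t + ψ (n - 1) t + (V n : ℂ) * ψ n t)) t
  hasSum : ∀ t, HasSum (fun n => ‖ψ n t‖ ^ 2) 1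
  init : ∀ n, ψ n 0 = if n = 1 then 1 else 0

theorem isSelfAdjoint_schrodingerOp (V : ℤ → ℝ) (hV : ∃ C, ∀ n, |V n| ≤ C) :
    IsSelfAdjoint (schrodingerOp V hV) := by
  rw [ContinuousLinearMap.isSelfAdjoint_iff_isSymmetric]
  have hshift : ∀ (k : ℤ) (f g : ℓ²(ℤ, ℂ)),
      inner ℂ (shift k f) g = inner ℂ f (shift (-k) g) := by
    intro k f g
    rw [lp.inner_eq_tsum, lp.inner_eq_tsum]
    refine Eq.trans (tsum_congr fun n => ?_)
      ((Equiv.addRight k).tsum_eq fun n => inner ℂ (f n) (shift (-k) g n))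
    change inner ℂ (f (n + k)) (g n) = inner ℂ (f (n + k)) (g (n + k + -k))
    rw [add_neg_cancel_right]
  have hmul : ∀ f g : ℓ²(ℤ, ℂ),
      inner ℂ (mulPotential V hV f) g = inner ℂ f (mulPotential V hV g) := by
    intro f g
    rw [lp.inner_eq_tsum, lp.inner_eq_tsum]
    refine tsum_congr fun n => ?_
    change inner ℂ ((V n : ℂ) * f n) (g n) = inner ℂ (f n) ((V n : ℂ) * g n)
    simp only [RCLike.inner_apply, map_mul, Complex.conj_ofReal]
    ring
  intro f g
  change inner ℂ (shift 1 f + shift (-1) f + mulPotential V hV f) g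
    = inner ℂ f (shift 1 g + shift (-1) g + mulPotential V hV g)
  rw [inner_add_left, inner_add_left, inner_add_right, inner_add_right, hshift, hshift, hmul,
    neg_neg, add_comm (inner ℂ f (shift (-1) g))]

theorem norm_propagator_apply {H : ℓ²(ℤ, ℂ) →L[ℂ] ℓ²(ℤ, ℂ)} (hH : IsSelfAdjoint H) (t : ℝ)
    (f : ℓ²(ℤ, ℂ)) : ‖propagator H t f‖ = ‖f‖ := by
  have hs : IsSelfAdjoint (((-t : ℝ) : ℂ) • H) :=
    IsSelfAdjoint.smul (by simp [isSelfAdjoint_iff]) hH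
  have e : propagator H t = ((selfAdjoint.expUnitary ⟨((-t : ℝ) : ℂ) • H, hs⟩ :
      unitary (ℓ²(ℤ, ℂ) →L[ℂ] ℓ²(ℤ, ℂ))) : ℓ²(ℤ, ℂ) →L[ℂ] ℓ²(ℤ, ℂ)) := by
    rw [selfAdjoint.expUnitary_coe, propagator, smul_smul]
    congr 2
    push_cast
    ring
  rw [e]
  exact Unitary.norm_map _ f

theorem inner_delta_left (n : ℤ) (f : ℓ²(ℤ, ℂ)) : inner ℂ (delta n) f = f n := by
  rw [delta, lp.inner_single_left]
  simp

theorem isEvolution_schrodingerOp (V : ℤ → ℝ) (hV : ∃ C, ∀ n, |V n| ≤ C) :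
    IsEvolution V fun n t =>
      inner ℂ (delta n) (propagator (schrodingerOp V hV) t (delta 1)) where
  hasDerivAt n t := by
    set H := schrodingerOp V hV with hH
    have h1 : HasDerivAt (fun u : ℂ => NormedSpace.exp (u • (-Complex.I • H)))
        ((-Complex.I • H) * NormedSpace.exp ((t : ℂ) • (-Complex.I • H))) (t : ℂ) :=
      hasDerivAt_exp_smul_const' (𝕂 := ℂ) (-Complex.I • H) (t : ℂ)
    have h2 := ((innerSL ℂ (delta n)).comp
      (ContinuousLinearMap.apply ℂ ℓ²(ℤ, ℂ) (delta 1))).hasFDerivAt.comp_hasDerivAt (t : ℂ) h1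
    have e : ∀ u : ℝ, (u : ℂ) • (-Complex.I • H) = (-(Complex.I * (u : ℂ))) • H := fun u => by
      rw [smul_smul]; congr 1; ring
    have h3 := h2.comp_ofReal
    have h4 : HasDerivAt (fun u : ℝ => inner ℂ (delta n) (propagator H u (delta 1)))
        (inner ℂ (delta n) (((-Complex.I • H) *
          NormedSpace.exp ((t : ℂ) • (-Complex.I • H))) (delta 1))) t := by
      refine h3.congr_of_eventuallyEq (Filter.Eventually.of_forall fun u => ?_)
      change inner ℂ (delta n) (propagator H u (delta 1))
        = inner ℂ (delta n) (NormedSpace.exp ((u : ℂ) • (-Complex.I • H)) (delta 1))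
      rw [e]
      rfl
    convert h4 using 1
    rw [e]
    change _ = inner ℂ (delta n) (-Complex.I • H (propagator H t (delta 1)))
    rw [inner_smul_right, inner_delta_left, inner_delta_left, inner_delta_left, inner_delta_left,
      hH, schrodingerOp_apply]
  hasSum t := by
    have h1 := lp.hasSum_norm (p := 2) (by norm_num)
      (propagator (schrodingerOp V hV) t (delta 1))
    rw [norm_propagator_apply (isSelfAdjoint_schrodingerOp V hV)] at h1
    have h2 : ‖delta 1‖ = 1 := by rw [delta, lp.norm_single (by norm_num)]; simp
    simp only [inner_delta_left]
    simpa [h2] using h1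
  init n := by
    have : propagator (schrodingerOp V hV) 0 = 1 := by simp [propagator]
    rw [this, inner_delta_left, one_apply_eq_self, delta, lp.single_apply]
    by_cases h : n = 1
    · subst h; simp
    · simp [h]

namespace IsEvolution

variable {V : ℤ → ℝ} {ψ : ℤ → ℝ → ℂ}

theorem continuous (h : IsEvolution V ψ) (n : ℤ) : Continuous (ψ n) :=
  continuous_iff_continuousAt.2 fun t => (h.hasDerivAt n t).continuousAt

theorem norm_le_one (h : IsEvolution V ψ) (n : ℤ) (t : ℝ) : ‖ψ n t‖ ≤ 1 := by
  have h1 := le_hasSum (h.hasSum t) n fun _ _ => by positivity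
  exact (sq_le_one_iff₀ (norm_nonneg _)).1 h1

end IsEvolution

/-- The Laplace transform `∫₀^∞ e^{izt} f(t) dt`. -/
noncomputable def laplace (f : ℝ → ℂ) (z : ℂ) : ℂ :=
  ∫ t in Set.Ioi (0 : ℝ), Complex.exp (Complex.I * z * t) * f t

theorem norm_exp_I_mul (z : ℂ) (t : ℝ) :
    ‖Complex.exp (Complex.I * z * t)‖ = Real.exp (-z.im * t) := by
  rw [Complex.norm_exp]; simp

theorem integrableOn_laplace {f : ℝ → ℂ} (hf : Continuous f) {C : ℝ} (hC : ∀ t, ‖f t‖ ≤ C) {z : ℂ}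
    (hz : 0 < z.im) : MeasureTheory.IntegrableOn (fun t : ℝ => Complex.exp (Complex.I * z * t) * f t)
      (Set.Ioi 0) := by
  have h1 := (exp_neg_integrableOn_Ioi 0 hz).mul_const C
  refine MeasureTheory.Integrable.mono' h1 ?_ (Filter.Eventually.of_forall fun t => ?_)
  · exact Continuous.aestronglyMeasurable (by fun_prop)
  · rw [norm_mul, norm_exp_I_mul]
    exact mul_le_mul_of_nonneg_left (hC t) (Real.exp_nonneg _)

theorem norm_laplace_le {f : ℝ → ℂ} (hC : ∀ t, ‖f t‖ ≤ 1) {z : ℂ} (hz : 0 < z.im) :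
    ‖laplace f z‖ ≤ 1 / z.im := by
  have h1 := exp_neg_integrableOn_Ioi 0 hz
  refine (MeasureTheory.norm_integral_le_of_norm_le h1
    (Filter.Eventually.of_forall fun t => ?_)).trans_eq ?_
  · rw [norm_mul, norm_exp_I_mul]
    exact mul_le_of_le_one_right (Real.exp_nonneg _) (hC t)
  · rw [integral_exp_mul_Ioi (by linarith)]
    simp

namespace IsEvolution

variable {V : ℤ → ℝ} {ψ : ℤ → ℝ → ℂ}

/-- Away from the source, the Laplace transform of the evolution solves the eigenvalue equation. -/
theorem laplace_eq (h : IsEvolution V ψ) {z : ℂ} (hz : 0 < z.im) {n : ℤ} (hn : n ≠ 1) :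
    laplace (ψ (n + 1)) z + laplace (ψ (n - 1)) z + V n * laplace (ψ n) z
      = z * laplace (ψ n) z := by
  have hI : ∀ m, MeasureTheory.IntegrableOn
      (fun t : ℝ => Complex.exp (Complex.I * z * t) * ψ m t) (Set.Ioi 0) := fun m =>
    integrableOn_laplace (h.continuous m) (h.norm_le_one m) hz
  have hd : ∀ t : ℝ, HasDerivAt (fun t : ℝ => Complex.exp (Complex.I * z * t) * ψ n t)
      (Complex.I * z * (Complex.exp (Complex.I * z * t) * ψ n t) - Complex.I *
        (Complex.exp (Complex.I * z * t) * ψ (n + 1) t + Complex.exp (Complex.I * z * t) * ψ (n - 1) t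
          + V n * (Complex.exp (Complex.I * z * t) * ψ n t))) t := by
    intro t
    have h1 : HasDerivAt (fun t : ℝ => Complex.exp (Complex.I * z * t))
        (Complex.exp (Complex.I * z * t) * (Complex.I * z)) t := by
      have : HasDerivAt (fun u : ℂ => Complex.I * z * u) (Complex.I * z) (t : ℂ) := by
        simpa using (hasDerivAt_id (t : ℂ)).const_mul (Complex.I * z)
      exact this.cexp.comp_ofReal
    exact (h1.mul (h.hasDerivAt n t)).congr_deriv (by ring)
  have hA : MeasureTheory.IntegrableOn (fun t : ℝ => Complex.exp (Complex.I * z * t) * ψ (n + 1) t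
      + Complex.exp (Complex.I * z * t) * ψ (n - 1) t) (Set.Ioi 0) := (hI (n + 1)).add (hI (n - 1))
  have hB : MeasureTheory.IntegrableOn (fun t : ℝ => Complex.exp (Complex.I * z * t) * ψ (n + 1) t
      + Complex.exp (Complex.I * z * t) * ψ (n - 1) t
      + V n * (Complex.exp (Complex.I * z * t) * ψ n t)) (Set.Ioi 0) :=
    hA.add ((hI n).const_mul (V n : ℂ))
  have hint := ((hI n).const_mul (Complex.I * z)).sub (hB.const_mul Complex.I)
  have hlim : Filter.Tendsto (fun t : ℝ => Complex.exp (Complex.I * z * t) * ψ n t) Filter.atTop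
      (nhds 0) := by
    refine squeeze_zero_norm (a := fun t => Real.exp (-z.im * t)) (fun t => ?_) ?_
    · rw [norm_mul, norm_exp_I_mul]
      exact mul_le_of_le_one_right (Real.exp_nonneg _) (h.norm_le_one n t)
    · exact Real.tendsto_exp_atBot.comp
        (Filter.tendsto_id.const_mul_atTop_of_neg (by linarith))
  have key := MeasureTheory.integral_Ioi_of_hasDerivAt_of_tendsto' (a := 0) (fun t _ => hd t)
    hint hlim
  rw [h.init, if_neg hn] at key
  rw [MeasureTheory.integral_sub ((hI n).const_mul _) (hB.const_mul Complex.I),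
    MeasureTheory.integral_const_mul, MeasureTheory.integral_const_mul,
    MeasureTheory.integral_add hA ((hI n).const_mul (V n : ℂ)),
    MeasureTheory.integral_add (hI (n + 1)) (hI (n - 1)),
    MeasureTheory.integral_const_mul] at key
  change Complex.I * z * laplace (ψ n) z - Complex.I * (laplace (ψ (n + 1)) z +
    laplace (ψ (n - 1)) z + V n * laplace (ψ n) z) = _ at key
  have hI0 := Complex.I_ne_zero
  apply mul_left_cancel₀ hI0
  linear_combination -key

theorem isHalfLineSol_right (h : IsEvolution V ψ) {z : ℂ} (hz : 0 < z.im) :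
    IsHalfLineSol (fun j => V (1 + j)) z fun j => laplace (ψ (1 + j)) z := by
  intro j
  have := h.laplace_eq hz (n := 1 + (j + 1 : ℕ)) (by push_cast; omega)
  push_cast at *
  rw [show (1 + (j + 1) - 1 : ℤ) = 1 + j by ring, show (1 + (j + 1) + 1 : ℤ) = 1 + (j + 2) by ring]
    at this
  linear_combination this

theorem isHalfLineSol_left (h : IsEvolution V ψ) {z : ℂ} (hz : 0 < z.im) :
    IsHalfLineSol (fun j => V (1 - j)) z fun j => laplace (ψ (1 - j)) z := by
  intro j
  have := h.laplace_eq hz (n := 1 - (j + 1 : ℕ)) (by push_cast; omega)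
  push_cast at *
  rw [show (1 - (j + 1) - 1 : ℤ) = 1 - (j + 2) by ring, show (1 - (j + 1) + 1 : ℤ) = 1 - j by ring]
    at this
  linear_combination this

open scoped FourierTransform in
/-- Fourier inversion: a bound `η / (1 + E²)` on the Laplace transform along the line of height `ε`
bounds the amplitude for all positive times. -/
theorem norm_le_of_laplace_le (h : IsEvolution V ψ) {n : ℤ} (hn : n ≠ 1) {ε η : ℝ} (hε : 0 < ε)
    (hη : ∀ E : ℝ, (1 + E ^ 2) * ‖laplace (ψ n) (E + ε * Complex.I)‖ ≤ η) {t : ℝ} (ht : 0 ≤ t) :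
    ‖ψ n t‖ ≤ Real.exp (ε * t) * (Real.pi * η) := by
  have hη0 : 0 ≤ η := le_trans (by positivity) (hη 0)
  -- the vanishing of `ψ n 0` makes the extension by zero to negative times continuous
  set g : ℝ → ℂ := fun t => Complex.exp (-ε * t) * ψ n (max t 0) with hg
  have hgc : Continuous g := by
    have := h.continuous n
    fun_prop
  have hg0 : ∀ t ∉ Set.Ioi (0 : ℝ), g t = 0 := by
    intro t ht
    rw [hg]
    simp only
    rw [max_eq_right (by simpa using ht), h.init, if_neg hn, mul_zero]
  have hgI : MeasureTheory.Integrable g := by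
    rw [← MeasureTheory.integrableOn_iff_integrable_of_support_subset (s := Set.Ioi 0)
      (fun t ht => by by_contra hc; exact ht (hg0 t hc))]
    have := integrableOn_laplace (f := fun t => ψ n (max t 0)) (z := ε * Complex.I)
      (by have := h.continuous n
          fun_prop) (fun t => h.norm_le_one n _) (by simpa using hε)
    refine this.congr_fun (fun t _ => ?_) measurableSet_Ioi
    simp only [hg]
    congr 2
    linear_combination (ε * t : ℂ) * Complex.I_mul_I
  have hF : ∀ ξ : ℝ, 𝓕 g ξ = laplace (ψ n) (((-2 * Real.pi * ξ : ℝ) : ℂ) + ε * Complex.I) := by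
    intro ξ
    rw [Real.fourier_real_eq_integral_exp_smul, laplace,
      ← MeasureTheory.setIntegral_eq_integral_of_forall_compl_eq_zero (s := Set.Ioi 0)
        (fun t ht => by rw [hg0 t ht, smul_zero])]
    refine MeasureTheory.setIntegral_congr_fun measurableSet_Ioi fun t ht => ?_
    simp only [hg, smul_eq_mul]
    rw [max_eq_left (le_of_lt ht), ← mul_assoc, ← Complex.exp_add]
    congr 2
    push_cast
    linear_combination (-ε * t : ℂ) * Complex.I_mul_I
  have hFb : ∀ ξ : ℝ, ‖𝓕 g ξ‖ ≤ η * (1 + ξ ^ 2)⁻¹ := by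
    intro ξ
    have h1 := hη (-2 * Real.pi * ξ)
    rw [hF, ← div_eq_mul_inv, le_div_iff₀ (by positivity), mul_comm]
    refine le_trans (mul_le_mul_of_nonneg_right ?_ (norm_nonneg _)) h1
    have : ξ ^ 2 * 1 ≤ ξ ^ 2 * (2 * Real.pi) ^ 2 := by
      gcongr
      nlinarith [Real.pi_gt_three]
    nlinarith
  have hbI : MeasureTheory.Integrable fun ξ : ℝ => η * (1 + ξ ^ 2)⁻¹ :=
    integrable_inv_one_add_sq.const_mul η
  have hFc : Continuous (𝓕 g) := by
    exact VectorFourier.fourierIntegral_continuous Real.continuous_fourierChar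
      (by exact continuous_inner) hgI
  have hFI : MeasureTheory.Integrable (𝓕 g) :=
    MeasureTheory.Integrable.mono' hbI hFc.aestronglyMeasurable (Filter.Eventually.of_forall hFb)
  have hinv := congrFun (hgc.fourierInv_fourier_eq hgI hFI) t
  have hgt : ‖g t‖ ≤ η * Real.pi := by
    rw [← hinv, Real.fourierInv_eq',
      show η * Real.pi = ∫ ξ : ℝ, η * (1 + ξ ^ 2)⁻¹ by
        rw [MeasureTheory.integral_const_mul, integral_univ_inv_one_add_sq]]
    refine MeasureTheory.norm_integral_le_of_norm_le hbI (Filter.Eventually.of_forall fun ξ => ?_)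
    rw [norm_smul, Complex.norm_exp_ofReal_mul_I, one_mul]
    exact hFb ξ
  rw [hg] at hgt
  simp only [max_eq_left ht, norm_mul, Complex.norm_exp] at hgt
  have e : (-(ε : ℂ) * t).re = -(ε * t) := by simp
  rw [e, Real.exp_neg, inv_mul_le_iff₀ (Real.exp_pos _)] at hgt
  linarith

end IsEvolution

/-! ### Time-averaged probabilities -/

theorem lintegral_weight {T : ℝ} (hT : 0 < T) :
    ∫⁻ t in Set.Ioi (0 : ℝ), ENNReal.ofReal (2 / T * Real.exp (-2 * t / T)) = 1 := by
  have hneg : -2 / T < 0 := div_neg_of_neg_of_pos (by norm_num) hT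
  have e : ∀ t : ℝ, 2 / T * Real.exp (-2 * t / T) = 2 / T * Real.exp (-2 / T * t) := fun t => by
    rw [div_mul_eq_mul_div (-2 : ℝ)]
  simp only [e]
  rw [← MeasureTheory.ofReal_integral_eq_lintegral_ofReal
    ((integrableOn_exp_mul_Ioi hneg 0).const_mul _)
    (Filter.Eventually.of_forall fun t => by positivity), MeasureTheory.integral_const_mul,
    integral_exp_mul_Ioi hneg]
  simp only [mul_zero, Real.exp_zero]
  rw [← ENNReal.ofReal_one]
  congr 1
  field_simp

section

variable (V : ℤ → ℝ) (hV : ∃ C, ∀ n, |V n| ≤ C)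

theorem tsum_avgProb {T : ℝ} (hT : 0 < T) :
    ∑' n, avgProb (schrodingerOp V hV) n T = 1 := by
  have h := isEvolution_schrodingerOp V hV
  unfold avgProb
  rw [← MeasureTheory.lintegral_tsum fun n => ?_, ← lintegral_weight hT]
  · congr 1
    ext t
    rw [← ENNReal.ofReal_tsum_of_nonneg (fun n => by positivity)
      (((h.hasSum t).summable.mul_left _).mul_left _), tsum_mul_left, tsum_mul_left,
      (h.hasSum t).tsum_eq, mul_one]
  · have hc := h.continuous n
    exact Measurable.aemeasurable (by fun_prop)

theorem avgProb_le_of_norm_le {T η : ℝ} (hT : 0 < T) {n : ℤ}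
    (h : ∀ t : ℝ, 0 ≤ t → ‖inner ℂ (delta n) (propagator (schrodingerOp V hV) t (delta 1))‖
      ≤ Real.exp (1 / (2 * T) * t) * (Real.pi * η)) :
    avgProb (schrodingerOp V hV) n T ≤ ENNReal.ofReal (2 * Real.pi ^ 2 * η ^ 2) := by
  have hneg : -1 / T < 0 := div_neg_of_neg_of_pos (by norm_num) hT
  have hI : MeasureTheory.IntegrableOn
      (fun t : ℝ => 2 / T * (Real.pi * η) ^ 2 * Real.exp (-1 / T * t)) (Set.Ioi 0) :=
    (integrableOn_exp_mul_Ioi hneg 0).const_mul _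
  calc avgProb (schrodingerOp V hV) n T
      ≤ ∫⁻ t in Set.Ioi (0 : ℝ), ENNReal.ofReal
        (2 / T * (Real.pi * η) ^ 2 * Real.exp (-1 / T * t)) := by
        refine MeasureTheory.setLIntegral_mono' measurableSet_Ioi fun t ht => ?_
        refine ENNReal.ofReal_le_ofReal ?_
        have h1 : Real.exp (-1 / T * t)
            = Real.exp (-2 * t / T) * Real.exp (1 / (2 * T) * t) ^ 2 := by
          rw [← Real.exp_nat_mul, ← Real.exp_add]
          congr 1
          push_cast
          field_simp
          norm_num
        rw [h1]
        calc _ ≤ 2 / T * (Real.exp (-2 * t / T) *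
              (Real.exp (1 / (2 * T) * t) * (Real.pi * η)) ^ 2) := by
              have := h t (le_of_lt ht)
              gcongr
          _ = _ := by ring
    _ = ENNReal.ofReal (2 * Real.pi ^ 2 * η ^ 2) := by
        rw [← MeasureTheory.ofReal_integral_eq_lintegral_ofReal hI
          (Filter.Eventually.of_forall fun t => by positivity), MeasureTheory.integral_const_mul,
          integral_exp_mul_Ioi hneg]
        congr 1
        simp only [mul_zero, Real.exp_zero]
        field_simp

end

/-- The pointwise estimate behind the lower bound on escape from the origin: the mass at `0` is,
up to a time derivative, controlled by the amplitudes at `-1` and `-2`. -/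
theorem IsEvolution.sq_norm_zero_le {V : ℤ → ℝ} {ψ : ℤ → ℝ → ℂ} (h : IsEvolution V ψ) {l : ℝ}
    (hl : ∀ n, |V n| ≤ l) (t : ℝ) :
    ‖ψ 0 t‖ ^ 2 ≤ (Complex.I * (star (-Complex.I * (ψ (0 + 1) t + ψ (0 - 1) t + (V 0 : ℂ) * ψ 0 t))
      * ψ (-1) t + star (ψ 0 t) * (-Complex.I *
        (ψ (-1 + 1) t + ψ (-1 - 1) t + (V (-1) : ℂ) * ψ (-1) t)))).re
      + (2 + 2 * l) * ‖ψ (-1) t‖ + ‖ψ (-2) t‖ := by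
  have h1 := h.norm_le_one 1 t
  have h0 := h.norm_le_one 0 t
  have hm := h.norm_le_one (-1) t
  set a := ψ 0 t
  set b := ψ (-1) t
  set c := ψ (-2) t
  set d := ψ 1 t
  have e : (Complex.I * (star (-Complex.I * (d + b + (V 0 : ℂ) * a)) * b
      + star a * (-Complex.I * (a + c + (V (-1) : ℂ) * b)))).re
      = ‖a‖ ^ 2 + (star a * (c + (V (-1) : ℂ) * b)).re
        - (star (d + b + (V 0 : ℂ) * a) * b).re := by
    rw [← Complex.normSq_eq_norm_sq, Complex.normSq_apply]
    simp [Complex.add_re, Complex.mul_re, Complex.mul_im]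
    ring
  change ‖a‖ ^ 2 ≤ (Complex.I * (star (-Complex.I * (d + b + (V 0 : ℂ) * a)) * b
      + star a * (-Complex.I * (a + c + (V (-1) : ℂ) * b)))).re + (2 + 2 * l) * ‖b‖ + ‖c‖
  rw [e]
  have hV : ∀ (n : ℤ) (x : ℂ), ‖(V n : ℂ) * x‖ ≤ l * ‖x‖ := fun n x => by
    rw [norm_mul, Complex.norm_real, Real.norm_eq_abs]
    exact mul_le_mul_of_nonneg_right (hl n) (norm_nonneg _)
  have hl0 : 0 ≤ l := (abs_nonneg _).trans (hl 0)
  have e1 : -(star a * (c + (V (-1) : ℂ) * b)).re ≤ ‖c‖ + l * ‖b‖ := by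
    refine (neg_le_abs _).trans ((Complex.abs_re_le_norm _).trans ?_)
    rw [norm_mul, norm_star]
    refine (mul_le_of_le_one_left (norm_nonneg _) h0).trans ((norm_add_le _ _).trans ?_)
    linarith [hV (-1) b]
  have e2 : (star (d + b + (V 0 : ℂ) * a) * b).re ≤ (2 + l) * ‖b‖ := by
    refine (Complex.re_le_norm _).trans ?_
    rw [norm_mul, norm_star]
    refine mul_le_mul_of_nonneg_right ?_ (norm_nonneg _)
    refine (norm_add_le _ _).trans ((add_le_add (norm_add_le _ _) (hV 0 a)).trans ?_)
    have : l * ‖a‖ ≤ l := mul_le_of_le_one_right hl0 h0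
    linarith
  linarith

/-- A fixed fraction of the time-averaged mass sits off the origin: since `iψ₋₁' = ψ₀ + ⋯`, mass at `0`
feeds the amplitude at `-1`. -/
theorem avgProb_zero_le {l : ℝ} (hl0 : 0 ≤ l) : ∃ c : ℝ, 0 < c ∧ c ≤ 1 ∧ ∀ (V : ℤ → ℝ)
    (hV : ∃ C, ∀ n, |V n| ≤ C), (∀ n, |V n| ≤ l) → ∀ T : ℝ, 1 ≤ T →
      avgProb (schrodingerOp V hV) 0 T ≤ ENNReal.ofReal (1 - c) := by
  set D := 4 + 2 * l with hD
  have hDpos : 0 < D := by positivity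
  refine ⟨3 / 4 / (1 + 8 * D ^ 2), by positivity, ?_, fun V hV hl T hT => ?_⟩
  · rw [div_le_one (by positivity)]; nlinarith
  have hT0 : 0 < T := by linarith
  have h := isEvolution_schrodingerOp V hV
  set ψ : ℤ → ℝ → ℂ := fun n t =>
    inner ℂ (delta n) (propagator (schrodingerOp V hV) t (delta 1)) with hψ
  set w : ℝ → ℝ := fun t => 2 / T * Real.exp (-2 / T * t) with hw
  have hneg : -2 / T < 0 := div_neg_of_neg_of_pos (by norm_num) hT0
  have hwI : MeasureTheory.IntegrableOn w (Set.Ioi 0) :=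
    (integrableOn_exp_mul_Ioi hneg 0).const_mul _
  have hw1 : ∫ t in Set.Ioi (0 : ℝ), w t = 1 := by
    rw [hw, MeasureTheory.integral_const_mul, integral_exp_mul_Ioi hneg]
    simp only [mul_zero, Real.exp_zero]
    field_simp
  have hw0 : ∀ t, 0 ≤ w t := fun t => by positivity
  have hwd : ∀ t, HasDerivAt w (-(2 / T) * w t) t := by
    intro t
    have h1 : HasDerivAt (fun t : ℝ => -2 / T * t) (-2 / T) t := by
      simpa using (hasDerivAt_id t).const_mul (-2 / T)
    exact (h1.exp.const_mul (2 / T)).congr_deriv (by simp only [hw]; ring)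
  set F : ℝ → ℂ := fun t => Complex.I * (star (ψ 0 t) * ψ (-1) t) with hF
  set F' : ℝ → ℂ := fun t => Complex.I *
    (star (-Complex.I * (ψ (0 + 1) t + ψ (0 - 1) t + (V 0 : ℂ) * ψ 0 t)) * ψ (-1) t
      + star (ψ 0 t) * (-Complex.I *
        (ψ (-1 + 1) t + ψ (-1 - 1) t + (V (-1) : ℂ) * ψ (-1) t))) with hF'
  have hFd : ∀ t, HasDerivAt F (F' t) t := fun t =>
    ((h.hasDerivAt 0 t).star.mul (h.hasDerivAt (-1) t)).const_mul Complex.I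
  have hFre : ∀ t, HasDerivAt (fun t => (F t).re) (F' t).re t := fun t =>
    Complex.reCLM.hasFDerivAt.comp_hasDerivAt t (hFd t)
  have hQd : ∀ t, HasDerivAt (fun t => w t * (F t).re)
      (-(2 / T) * w t * (F t).re + w t * (F' t).re) t := fun t => (hwd t).mul (hFre t)
  have hc := h.continuous
  have hwc : Continuous w := by fun_prop
  have hFn : ∀ t, ‖F t‖ ≤ ‖ψ (-1) t‖ := fun t => by
    rw [hF]
    simp only [norm_mul, Complex.norm_I, one_mul, norm_star]
    exact mul_le_of_le_one_left (norm_nonneg _) (h.norm_le_one 0 t)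
  have hFn1 : ∀ t, |(F t).re| ≤ 1 := fun t =>
    (Complex.abs_re_le_norm _).trans ((hFn t).trans (h.norm_le_one _ t))
  have hψd : ∀ n t, ‖-Complex.I * (ψ (n + 1) t + ψ (n - 1) t + (V n : ℂ) * ψ n t)‖ ≤ 2 + l := by
    intro n t
    rw [norm_mul, norm_neg, Complex.norm_I, one_mul]
    refine (norm_add_le _ _).trans ((add_le_add (norm_add_le _ _) le_rfl).trans ?_)
    rw [norm_mul, Complex.norm_real, Real.norm_eq_abs]
    have h1 := h.norm_le_one (n + 1) t
    have h2 := h.norm_le_one (n - 1) t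
    have h3 := mul_le_of_le_one_right (abs_nonneg (V n)) (h.norm_le_one n t)
    linarith [hl n]
  have hF'n : ∀ t, |(F' t).re| ≤ 2 * (2 + l) := by
    intro t
    refine (Complex.abs_re_le_norm _).trans ?_
    rw [hF']
    simp only
    rw [norm_mul, Complex.norm_I, one_mul]
    refine (norm_add_le _ _).trans ?_
    rw [norm_mul, norm_mul (star (ψ 0 t)), norm_star, norm_star]
    have h1 := mul_le_mul (hψd 0 t) (h.norm_le_one (-1) t) (norm_nonneg _) (by linarith)
    have h2 := mul_le_mul (h.norm_le_one 0 t) (hψd (-1) t) (norm_nonneg _) zero_le_one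
    linarith
  have hF'c : Continuous fun t => (F' t).re := by
    have h1 := hc 0
    have h2 := hc (-1)
    have h3 := hc (0 + 1)
    have h4 := hc (0 - 1)
    have h5 := hc (-1 + 1)
    have h6 := hc (-1 - 1)
    rw [hF']
    exact Complex.continuous_re.comp (by fun_prop)
  have hFc : Continuous fun t => (F t).re :=
    continuous_iff_continuousAt.2 fun t => (hFre t).continuousAt
  have hI1 : MeasureTheory.IntegrableOn (fun t => -(2 / T) * w t * (F t).re) (Set.Ioi 0) := by
    refine MeasureTheory.Integrable.mono' (hwI.const_mul (2 / T))
      (Continuous.aestronglyMeasurable (by fun_prop)) (Filter.Eventually.of_forall fun t => ?_)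
    rw [norm_mul, norm_mul, norm_neg, Real.norm_of_nonneg (by positivity : (0 : ℝ) ≤ 2 / T),
      Real.norm_of_nonneg (hw0 t)]
    exact mul_le_of_le_one_right (mul_nonneg (by positivity) (hw0 t)) (hFn1 t)
  have hI2 : MeasureTheory.IntegrableOn (fun t => w t * (F' t).re) (Set.Ioi 0) := by
    refine MeasureTheory.Integrable.mono' (hwI.mul_const (2 * (2 + l)))
      (Continuous.aestronglyMeasurable (by fun_prop)) (Filter.Eventually.of_forall fun t => ?_)
    rw [norm_mul, Real.norm_of_nonneg (hw0 t)]
    exact mul_le_mul_of_nonneg_left (hF'n t) (hw0 t)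
  have hQlim : Filter.Tendsto (fun t => w t * (F t).re) Filter.atTop (nhds 0) := by
    refine squeeze_zero_norm (a := w) (fun t => ?_) ?_
    · rw [norm_mul, Real.norm_of_nonneg (hw0 t)]
      exact mul_le_of_le_one_right (hw0 t) (hFn1 t)
    · have : Filter.Tendsto (fun t : ℝ => Real.exp (-2 / T * t)) Filter.atTop (nhds 0) :=
        Real.tendsto_exp_atBot.comp (Filter.tendsto_id.const_mul_atTop_of_neg hneg)
      simpa using this.const_mul (2 / T)
  have hQ := MeasureTheory.integral_Ioi_of_hasDerivAt_of_tendsto' (a := 0) (fun t _ => hQd t)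
    (hI1.add hI2) hQlim
  have hF0 : F 0 = 0 := by
    simp only [hF]
    rw [h.init 0, if_neg (by norm_num)]
    simp
  rw [hF0, Complex.zero_re, mul_zero, sub_zero] at hQ
  have hxI : MeasureTheory.IntegrableOn (fun t => w t * ‖ψ 0 t‖ ^ 2) (Set.Ioi 0) := by
    have := hc 0
    refine MeasureTheory.Integrable.mono' hwI
      (Continuous.aestronglyMeasurable (by fun_prop)) (Filter.Eventually.of_forall fun t => ?_)
    rw [norm_mul, Real.norm_of_nonneg (hw0 t), Real.norm_of_nonneg (by positivity)]
    exact mul_le_of_le_one_right (hw0 t) (pow_le_one₀ (norm_nonneg _) (h.norm_le_one 0 t))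
  set κ := 1 / (8 * D) with hκ
  have hκpos : 0 < κ := by positivity
  have hpt : ∀ t, w t * ‖ψ 0 t‖ ^ 2 ≤ (-(2 / T) * w t * (F t).re + w t * (F' t).re)
      + (D * (2 * κ + 1 / κ) * w t - D / κ * (w t * ‖ψ 0 t‖ ^ 2)) := by
    intro t
    have h1 := h.sq_norm_zero_le hl t
    change _ ≤ (F' t).re + _ + _ at h1
    have hy : ∀ y : ℝ, 0 ≤ y → y ≤ κ + y ^ 2 / κ := by
      intro y hy0
      have : κ + y ^ 2 / κ - y = ((κ - y / 2) ^ 2 + 3 / 4 * y ^ 2) / κ := by field_simp; ring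
      have : 0 ≤ κ + y ^ 2 / κ - y := by rw [this]; positivity
      linarith
    have h2 := hy _ (norm_nonneg (ψ (-1) t))
    have h3 := hy _ (norm_nonneg (ψ (-2) t))
    have h4 : ‖ψ 0 t‖ ^ 2 + ‖ψ (-1) t‖ ^ 2 + ‖ψ (-2) t‖ ^ 2 ≤ 1 := by
      have := sum_le_hasSum ({0, -1, -2} : Finset ℤ) (fun _ _ => by positivity) (h.hasSum t)
      rw [Finset.sum_insert (by decide), Finset.sum_insert (by decide), Finset.sum_singleton]
        at this
      linarith
    have h5 : -(2 / T * (F t).re) ≥ -(2 * ‖ψ (-1) t‖) := by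
      have a1 : 2 / T ≤ 2 := by rw [div_le_iff₀ hT0]; linarith
      have a2 : (F t).re ≤ ‖ψ (-1) t‖ := (Complex.re_le_norm _).trans (hFn t)
      have a3 : 2 / T * (F t).re ≤ 2 / T * ‖ψ (-1) t‖ := by gcongr
      have a4 : 2 / T * ‖ψ (-1) t‖ ≤ 2 * ‖ψ (-1) t‖ := by gcongr
      linarith
    have h6 : ‖ψ (-1) t‖ + ‖ψ (-2) t‖ ≤ 2 * κ + (1 - ‖ψ 0 t‖ ^ 2) / κ := by
      have : (‖ψ (-1) t‖ ^ 2 + ‖ψ (-2) t‖ ^ 2) / κ ≤ (1 - ‖ψ 0 t‖ ^ 2) / κ := by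
        gcongr; linarith
      rw [add_div] at this
      linarith
    have h7 : ‖ψ 0 t‖ ^ 2 ≤ -(2 / T * (F t).re) + (F' t).re
        + D * (2 * κ + (1 - ‖ψ 0 t‖ ^ 2) / κ) := by
      have := mul_le_mul_of_nonneg_left h6 hDpos.le
      have h8 : 0 ≤ (3 + 2 * l) * ‖ψ (-2) t‖ := by positivity
      rw [hD] at this ⊢
      linarith
    calc w t * ‖ψ 0 t‖ ^ 2 ≤ w t * (-(2 / T * (F t).re) + (F' t).re
        + D * (2 * κ + (1 - ‖ψ 0 t‖ ^ 2) / κ)) := mul_le_mul_of_nonneg_left h7 (hw0 t)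
      _ = _ := by ring
  set a := ∫ t in Set.Ioi (0 : ℝ), w t * ‖ψ 0 t‖ ^ 2 with ha
  have hI3 : MeasureTheory.IntegrableOn
      (fun t => D * (2 * κ + 1 / κ) * w t - D / κ * (w t * ‖ψ 0 t‖ ^ 2)) (Set.Ioi 0) :=
    (hwI.const_mul _).sub (hxI.const_mul _)
  have hI12 : MeasureTheory.IntegrableOn
      (fun t => -(2 / T) * w t * (F t).re + w t * (F' t).re) (Set.Ioi 0) := hI1.add hI2
  have hmain := MeasureTheory.integral_mono hxI (hI12.add hI3) hpt
  have hsplit : ∫ t in Set.Ioi (0 : ℝ), ((-(2 / T) * w t * (F t).re + w t * (F' t).re)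
      + (D * (2 * κ + 1 / κ) * w t - D / κ * (w t * ‖ψ 0 t‖ ^ 2)))
      = D * (2 * κ + 1 / κ) - D / κ * a := by
    rw [MeasureTheory.integral_add hI12 hI3, hQ,
      MeasureTheory.integral_sub (hwI.const_mul _) (hxI.const_mul _),
      MeasureTheory.integral_const_mul _ w, MeasureTheory.integral_const_mul (D / κ), hw1]
    ring
  have hmain' : a ≤ D * (2 * κ + 1 / κ) - D / κ * a := by
    rw [← hsplit]; exact hmain
  have hle : a ≤ 1 - 3 / 4 / (1 + 8 * D ^ 2) := by
    have e1 : D * (2 * κ + 1 / κ) = 1 / 4 + 8 * D ^ 2 := by rw [hκ]; field_simp; ring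
    have e2 : D / κ = 8 * D ^ 2 := by rw [hκ]; field_simp
    rw [e1, e2] at hmain'
    rw [le_sub_iff_add_le, ← le_sub_iff_add_le', div_le_iff₀ (by positivity)]
    linarith
  have hfin : avgProb (schrodingerOp V hV) 0 T = ENNReal.ofReal a := by
    rw [ha, MeasureTheory.ofReal_integral_eq_lintegral_ofReal hxI
      (Filter.Eventually.of_forall fun t => mul_nonneg (hw0 t) (by positivity)), avgProb]
    refine MeasureTheory.lintegral_congr fun t => ?_
    congr 1
    simp only [hw]
    rw [div_mul_eq_mul_div (-2 : ℝ)]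
    ring
  rw [hfin]
  exact ENNReal.ofReal_le_ofReal hle

/-! ### Superpolynomial smallness of the tails at a localizing scale -/

/-- Superpolynomial smallness, in time and in distance, of the averaged probabilities beyond `T ^ α`. -/
theorem avgProb_almostMathieu_le {lam α : ℝ} (hl : 2 < lam) (hα : 0 < α) (B : ℕ) {q : ℕ}
    (hq : 0 < q) : ∃ (s : ℕ) (T₁ : ℝ), ∀ θ T : ℝ, T₁ ≤ T →
      LocalizingScale lam θ (lam + 4) α s T → ∀ (ω : ℝ) (n : ℤ), T ^ α - 2 < |(n : ℝ)| →
      avgProb (almostMathieu lam θ ω) n T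
        ≤ ENNReal.ofReal ((T ^ B)⁻¹ * ((1 + |(n : ℝ)|) ^ q)⁻¹) := by
  obtain ⟨C, hC, hbound⟩ := exists_halfLine_bound hl hα (5 + q + B) hq
  obtain ⟨T₂, hT₂⟩ := Filter.eventually_atTop.1 ((tendsto_rpow_atTop hα).eventually_ge_atTop 6)
  refine ⟨5 + q + B, max (max T₂ 1) (2 * Real.pi ^ 2 * C * 2 ^ q), ?_⟩
  intro θ T hT hloc ω n hn
  have hT2 : 6 ≤ T ^ α := hT₂ T ((le_max_left _ _).trans ((le_max_left _ _).trans hT))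
  have hT1 : 1 ≤ T := (le_max_right _ _).trans ((le_max_left _ _).trans hT)
  have hT3 : 2 * Real.pi ^ 2 * C * 2 ^ q ≤ T := (le_max_right _ _).trans hT
  have hT0 : 0 < T := by linarith
  have hε : (0 : ℝ) < 1 / (2 * T) := by positivity
  have h := isEvolution_schrodingerOp (amoPotential lam θ ω) (amoPotential_bounded lam θ ω)
  set ψ : ℤ → ℝ → ℂ := fun n t => inner ℂ (delta n)
    (propagator (schrodingerOp (amoPotential lam θ ω) (amoPotential_bounded lam θ ω)) t (delta 1))
    with hψ
  set j := (n - 1).natAbs with hj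
  have hjn : |(n : ℝ)| ≤ j + 1 := by
    have : |n| ≤ j + 1 := by rw [Int.abs_eq_natAbs]; omega
    exact_mod_cast this
  have hj3 : 3 ≤ j := by
    have : (3 : ℝ) ≤ j + 1 := by linarith
    by_contra! hlt
    have h4 : (4 : ℝ) < |(n : ℝ)| + 1 := by linarith
    have h5 : (4 : ℤ) < |n| + 1 := by exact_mod_cast h4
    rw [Int.abs_eq_natAbs] at h5
    omega
  have hjT : T ^ α / 2 ≤ j := by linarith
  have hn1 : n ≠ 1 := by omega
  set η := Real.sqrt (C * T ^ (4 + q) / T ^ (5 + q + B) / (1 + j) ^ q) with hη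
  have hη2 : η ^ 2 = C * T ^ (4 + q) / T ^ (5 + q + B) / (1 + j) ^ q :=
    Real.sq_sqrt (by positivity)
  have hlap : ∀ E : ℝ,
      (1 + E ^ 2) * ‖laplace (ψ n) (E + (1 / (2 * T) : ℝ) * Complex.I)‖ ≤ η := by
    intro E
    apply Real.le_sqrt_of_sq_le
    set z : ℂ := E + (1 / (2 * T) : ℝ) * Complex.I with hz
    have hzim : z.im = 1 / (2 * T) := by rw [hz]; simp
    have hzpos : 0 < z.im := by rw [hzim]; exact hε
    have hb : ∀ m, ‖laplace (ψ m) z‖ ≤ 2 * T := fun m => by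
      refine (norm_laplace_le (h.norm_le_one m) hzpos).trans_eq ?_
      rw [hzim, one_div_one_div]
    rcases le_total 1 n with hn' | hn'
    · have hnj : n = 1 + (j : ℤ) := by omega
      have hsol := h.isHalfLineSol_right hzpos
      have hV : (fun j : ℕ => amoPotential lam θ ω (1 + j))
          = fun j : ℕ => amoPotential lam θ (ω + θ) j := by
        ext i
        rw [amoPotential, amoPotential]
        congr 3
        push_cast
        ring
      rw [hV] at hsol
      have := hbound θ T hT1 hloc (ω + θ) E _ hsol (fun m => hb _) j hj3 hjT
      rwa [← hnj] at this
    · have hnj : n = 1 - (j : ℤ) := by omega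
      have hsol := h.isHalfLineSol_left hzpos
      -- reflection turns the phase `ω` into `-ω - θ`
      have hV : (fun j : ℕ => amoPotential lam θ ω (1 - j))
          = fun j : ℕ => amoPotential lam θ (-ω - θ) j := by
        ext i
        rw [amoPotential, amoPotential, ← Real.cos_neg]
        congr 2
        push_cast
        ring
      rw [hV] at hsol
      have := hbound θ T hT1 hloc (-ω - θ) E _ hsol (fun m => hb _) j hj3 hjT
      rwa [← hnj] at this
  refine (avgProb_le_of_norm_le _ _ hT0 fun t ht =>
    h.norm_le_of_laplace_le hn1 hε hlap ht).trans (ENNReal.ofReal_le_ofReal ?_)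
  have h2 : (1 + |(n : ℝ)|) ^ q ≤ 2 ^ q * (1 + j) ^ q := by
    rw [← mul_pow]
    gcongr
    have : (0 : ℝ) ≤ j := Nat.cast_nonneg _
    linarith
  rw [hη2, ← mul_inv, show 2 * Real.pi ^ 2 * (C * T ^ (4 + q) / T ^ (5 + q + B) / (1 + j) ^ q)
    = 2 * Real.pi ^ 2 * C / (T * T ^ B * (1 + j) ^ q) by
      rw [show 5 + q + B = (4 + q) + (B + 1) by ring, pow_add T (4 + q),
        pow_succ T B]
      field_simp, ← one_div, div_le_div_iff₀ (by positivity) (by positivity), one_mul]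
  calc 2 * Real.pi ^ 2 * C * (T ^ B * (1 + |(n : ℝ)|) ^ q)
      ≤ 2 * Real.pi ^ 2 * C * (T ^ B * (2 ^ q * (1 + j) ^ q)) := by gcongr
    _ = (2 * Real.pi ^ 2 * C * 2 ^ q) * (T ^ B * (1 + j) ^ q) := by ring
    _ ≤ T * (T ^ B * (1 + j) ^ q) := by gcongr
    _ = _ := by ring

theorem summable_one_add_abs_int : Summable fun n : ℤ => ((1 + |(n : ℝ)|) ^ 2)⁻¹ := by
  have h1 : Summable fun n : ℕ => ((1 + (n : ℝ)) ^ 2)⁻¹ := by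
    have := (summable_nat_add_iff 1).2 (Real.summable_nat_pow_inv.2 one_lt_two)
    simpa [add_comm] using this
  refine Summable.of_nat_of_neg ?_ ?_ <;> simpa using h1

theorem tsum_ofReal_weight (c : ℝ) (hc : 0 ≤ c) :
    ∑' n : ℤ, ENNReal.ofReal (c * ((1 + |(n : ℝ)|) ^ 2)⁻¹)
      = ENNReal.ofReal (c * ∑' n : ℤ, ((1 + |(n : ℝ)|) ^ 2)⁻¹) := by
  rw [← tsum_mul_left, ENNReal.ofReal_tsum_of_nonneg (fun n => by positivity)
    (summable_one_add_abs_int.mul_left c)]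

theorem outsideProb_almostMathieu_le {lam α : ℝ} (hl : 2 < lam) (hα : 0 < α) (B : ℕ) :
    ∃ (s : ℕ) (T₁ : ℝ), ∀ θ T : ℝ, T₁ ≤ T → LocalizingScale lam θ (lam + 4) α s T →
      ∀ ω : ℝ, outsideProb (almostMathieu lam θ ω) (T ^ α - 2) T ≤ ENNReal.ofReal (T ^ B)⁻¹ := by
  obtain ⟨s, T₁, h⟩ := avgProb_almostMathieu_le hl hα (B + 1) (q := 2) (by norm_num)
  set S := ∑' n : ℤ, ((1 + |(n : ℝ)|) ^ 2)⁻¹ with hS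
  refine ⟨s, max T₁ (max S 1), fun θ T hT hloc ω => ?_⟩
  have hT1 : 1 ≤ T := (le_max_right _ _).trans ((le_max_right _ _).trans hT)
  have hTS : S ≤ T := (le_max_left _ _).trans ((le_max_right _ _).trans hT)
  calc outsideProb (almostMathieu lam θ ω) (T ^ α - 2) T
      ≤ ∑' n : {n : ℤ // T ^ α - 2 < |(n : ℝ)|},
        ENNReal.ofReal ((T ^ (B + 1))⁻¹ * ((1 + |((n : ℤ) : ℝ)|) ^ 2)⁻¹) :=
        ENNReal.tsum_le_tsum fun n => h θ T ((le_max_left _ _).trans hT) hloc ω n n.2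
    _ ≤ ∑' n : ℤ, ENNReal.ofReal ((T ^ (B + 1))⁻¹ * ((1 + |(n : ℝ)|) ^ 2)⁻¹) :=
        ENNReal.tsum_comp_le_tsum_of_injective Subtype.val_injective
          fun n : ℤ => ENNReal.ofReal ((T ^ (B + 1))⁻¹ * ((1 + |(n : ℝ)|) ^ 2)⁻¹)
    _ = ENNReal.ofReal ((T ^ (B + 1))⁻¹ * S) := tsum_ofReal_weight _ (by positivity)
    _ ≤ ENNReal.ofReal (T ^ B)⁻¹ := by
        refine ENNReal.ofReal_le_ofReal ?_
        rw [pow_succ, mul_inv, mul_assoc]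
        refine mul_le_of_le_one_right (by positivity) ?_
        rw [inv_mul_le_iff₀ (by linarith), mul_one]
        exact hTS

theorem avgMoment_almostMathieu_le {lam α p : ℝ} (hl : 2 < lam) (hα : 0 < α) (hp : 0 < p) :
    ∃ (s : ℕ) (T₁ : ℝ), ∀ θ T : ℝ, T₁ ≤ T → LocalizingScale lam θ (lam + 4) α s T →
      ∀ ω : ℝ, avgMoment (almostMathieu lam θ ω) p T ≤ ENNReal.ofReal (2 * T ^ (α * p)) := by
  obtain ⟨r, hr⟩ := exists_nat_ge p
  obtain ⟨s, T₁, h⟩ := avgProb_almostMathieu_le hl hα 1 (q := r + 2) (by omega)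
  set S := ∑' n : ℤ, ((1 + |(n : ℝ)|) ^ 2)⁻¹ with hS
  refine ⟨s, max T₁ (max S 1), fun θ T hT hloc ω => ?_⟩
  have hT1 : 1 ≤ T := (le_max_right _ _).trans ((le_max_right _ _).trans hT)
  have hTS : S ≤ T := (le_max_left _ _).trans ((le_max_right _ _).trans hT)
  have hT0 : 0 < T := by linarith
  have hterm : ∀ n : ℤ, ENNReal.ofReal (|(n : ℝ)| ^ p) * avgProb (almostMathieu lam θ ω) n T
      ≤ ENNReal.ofReal (T ^ (α * p)) * avgProb (almostMathieu lam θ ω) n T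
        + ENNReal.ofReal (T⁻¹ * ((1 + |(n : ℝ)|) ^ 2)⁻¹) := by
    intro n
    by_cases hn : T ^ α - 2 < |(n : ℝ)|
    · refine le_add_left ((mul_le_mul_right
        (h θ T ((le_max_left _ _).trans hT) hloc ω n hn) _).trans ?_)
      rw [← ENNReal.ofReal_mul (by positivity)]
      refine ENNReal.ofReal_le_ofReal ?_
      have h1 : |(n : ℝ)| ^ p ≤ (1 + |(n : ℝ)|) ^ r := by
        calc |(n : ℝ)| ^ p ≤ (1 + |(n : ℝ)|) ^ p := by gcongr; linarith
          _ ≤ (1 + |(n : ℝ)|) ^ (r : ℝ) :=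
            Real.rpow_le_rpow_of_exponent_le (by linarith [abs_nonneg (n : ℝ)]) hr
          _ = _ := Real.rpow_natCast _ _
      rw [pow_one, pow_add, mul_inv]
      calc |(n : ℝ)| ^ p * (T⁻¹ * (((1 + |(n : ℝ)|) ^ r)⁻¹ * ((1 + |(n : ℝ)|) ^ 2)⁻¹))
          ≤ (1 + |(n : ℝ)|) ^ r * (T⁻¹ * (((1 + |(n : ℝ)|) ^ r)⁻¹ * ((1 + |(n : ℝ)|) ^ 2)⁻¹)) := by
            gcongr
        _ = _ := by field_simp
    · refine le_add_right (mul_le_mul_left (ENNReal.ofReal_le_ofReal ?_) _)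
      rw [Real.rpow_mul hT0.le]
      gcongr
      linarith
  calc avgMoment (almostMathieu lam θ ω) p T
      ≤ ∑' n : ℤ, (ENNReal.ofReal (T ^ (α * p)) * avgProb (almostMathieu lam θ ω) n T
        + ENNReal.ofReal (T⁻¹ * ((1 + |(n : ℝ)|) ^ 2)⁻¹)) := ENNReal.tsum_le_tsum hterm
    _ = ENNReal.ofReal (T ^ (α * p)) + ENNReal.ofReal (T⁻¹ * S) := by
        rw [ENNReal.tsum_add, ENNReal.tsum_mul_left, tsum_ofReal_weight _ (by positivity),
          almostMathieu, tsum_avgProb _ _ hT0, mul_one]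
    _ ≤ ENNReal.ofReal (2 * T ^ (α * p)) := by
        have hS0 : 0 ≤ S := tsum_nonneg fun _ => by positivity
        rw [← ENNReal.ofReal_add (by positivity) (by positivity)]
        refine ENNReal.ofReal_le_ofReal ?_
        have h1 : 1 ≤ T ^ (α * p) := Real.one_le_rpow hT1 (by positivity)
        have h2 : T⁻¹ * S ≤ 1 := by rw [inv_mul_le_iff₀ hT0, mul_one]; exact hTS
        linarith

/-- The site `0` is the only one that the weight `|n| ^ p` suppresses, and it does not carry all the mass. -/
theorem le_avgMoment_almostMathieu {lam : ℝ} (hl : 0 ≤ lam) : ∃ c : ℝ, 0 < c ∧ ∀ θ ω p T : ℝ,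
    0 < p → 1 ≤ T → ENNReal.ofReal c ≤ avgMoment (almostMathieu lam θ ω) p T := by
  obtain ⟨c, hc, hc', h⟩ := avgProb_zero_le hl
  refine ⟨c, hc, fun θ ω p T hp hT => ?_⟩
  have h0 := h _ (amoPotential_bounded lam θ ω) (abs_amoPotential_le hl θ ω) T hT
  change avgProb (almostMathieu lam θ ω) 0 T ≤ _ at h0
  have hsum : ∑' n, avgProb (almostMathieu lam θ ω) n T = 1 := tsum_avgProb _ _ (by linarith)
  have hle : (1 : ℝ≥0∞) ≤ ENNReal.ofReal (1 - c) + avgMoment (almostMathieu lam θ ω) p T := by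
    rw [← hsum]
    calc ∑' n, avgProb (almostMathieu lam θ ω) n T
        ≤ ∑' n : ℤ, ((if n = 0 then avgProb (almostMathieu lam θ ω) 0 T else 0)
          + ENNReal.ofReal (|(n : ℝ)| ^ p) * avgProb (almostMathieu lam θ ω) n T) := by
          refine ENNReal.tsum_le_tsum fun n => ?_
          by_cases hn : n = 0
          · rw [if_pos hn, hn]; exact le_self_add
          · refine le_add_left (le_mul_of_one_le_left zero_le ?_)
            rw [ENNReal.one_le_ofReal]
            refine Real.one_le_rpow ?_ hp.le
            exact_mod_cast Int.one_le_abs hn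
      _ = avgProb (almostMathieu lam θ ω) 0 T + avgMoment (almostMathieu lam θ ω) p T := by
          rw [ENNReal.tsum_add, tsum_ite_eq, avgMoment]
      _ ≤ _ := by gcongr
  by_contra! hlt
  have hc1 : ENNReal.ofReal (1 - c) ≠ ⊤ := ENNReal.ofReal_ne_top
  have := ENNReal.add_lt_add_left hc1 hlt
  rw [← ENNReal.ofReal_add (by linarith) hc.le, sub_add_cancel, ENNReal.ofReal_one] at this
  exact absurd hle (not_le.2 this)

/-! ### Transport exponents -/

theorem tailRate_le {H : ℓ²(ℤ, ℂ) →L[ℂ] ℓ²(ℤ, ℂ)} {α T : ℝ} {B : ℕ} (hT : 1 < T)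
    (h : outsideProb H (T ^ α - 2) T ≤ ENNReal.ofReal (T ^ B)⁻¹) :
    tailRate H α T ≤ ((-(B : ℝ) : ℝ) : EReal) := by
  have hlog : 0 < Real.log T := Real.log_pos hT
  have hT0 : 0 < T := by linarith
  have h1 : ENNReal.log (outsideProb H (T ^ α - 2) T) ≤ ((-(B : ℝ) * Real.log T : ℝ) : EReal) := by
    refine (ENNReal.log_monotone h).trans_eq ?_
    rw [ENNReal.log_ofReal_of_pos (by positivity), Real.log_inv, Real.log_pow]
    congr 1; ring
  rw [tailRate]
  refine (EReal.div_le_div_right_of_nonneg (by exact_mod_cast hlog.le) h1).trans_eq ?_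
  rw [← EReal.coe_div]
  congr 1
  field_simp

theorem tailRate_zero (V : ℤ → ℝ) (hV : ∃ C, ∀ n, |V n| ≤ C) {T : ℝ} (hT : 0 < T) :
    tailRate (schrodingerOp V hV) 0 T = 0 := by
  have h1 : outsideProb (schrodingerOp V hV) (T ^ (0 : ℝ) - 2) T = 1 := by
    rw [← tsum_avgProb V hV hT, outsideProb]
    refine (Equiv.subtypeUnivEquiv fun n : ℤ => ?_).tsum_eq
      fun n => avgProb (schrodingerOp V hV) n T
    rw [Real.rpow_zero]
    linarith [abs_nonneg (n : ℝ)]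
  rw [tailRate, h1, ENNReal.log_one, EReal.zero_div]

/-- The supremum is `0` and not `⊥` because `α = 0` belongs to the set: `P(T ^ 0 - 2, T)` is the total
mass `1`. -/
theorem alphaUMinus_eq_zero {V : ℤ → ℝ} {hV : ∃ C, ∀ n, |V n| ≤ C}
    (h : ∀ α : ℝ, 0 < α → ∀ B : ℕ, ∃ᶠ T in Filter.atTop,
      outsideProb (schrodingerOp V hV) (T ^ α - 2) T ≤ ENNReal.ofReal (T ^ B)⁻¹) :
    alphaUMinus (schrodingerOp V hV) = 0 := by
  apply le_antisymm
  · refine sSup_le ?_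
    rintro _ ⟨α, ⟨hα0, hα⟩, rfl⟩
    by_contra! hpos
    have hpos' : 0 < α := by exact_mod_cast hpos
    refine hα.ne ?_
    rw [SMinus, EReal.neg_eq_top_iff, EReal.eq_bot_iff_forall_lt]
    intro y
    obtain ⟨B, hB⟩ := exists_nat_gt (-y)
    have hfreq : ∃ᶠ T in Filter.atTop,
        tailRate (schrodingerOp V hV) α T ≤ ((-(B : ℝ) : ℝ) : EReal) :=
      ((h α hpos' B).and_eventually (Filter.eventually_gt_atTop 1)).mono
        fun T hT => tailRate_le hT.2 hT.1
    refine (Filter.liminf_le_of_frequently_le' hfreq).trans_lt ?_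
    exact_mod_cast (by linarith : -(B : ℝ) < y)
  · refine le_sSup ⟨0, ⟨le_rfl, ?_⟩, rfl⟩
    have h0 : (fun T => tailRate (schrodingerOp V hV) 0 T) =ᶠ[Filter.atTop] fun _ => 0 := by
      filter_upwards [Filter.eventually_gt_atTop 0] with T hT using tailRate_zero V hV hT
    rw [SMinus, Filter.liminf_congr h0, Filter.liminf_const]
    simp

theorem alphaUPlus_eq_zero {V : ℤ → ℝ} {hV : ∃ C, ∀ n, |V n| ≤ C}
    (h : ∀ α : ℝ, 0 < α → ∀ B : ℕ, ∀ᶠ T in Filter.atTop,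
      outsideProb (schrodingerOp V hV) (T ^ α - 2) T ≤ ENNReal.ofReal (T ^ B)⁻¹) :
    alphaUPlus (schrodingerOp V hV) = 0 := by
  apply le_antisymm
  · refine sSup_le ?_
    rintro _ ⟨α, ⟨hα0, hα⟩, rfl⟩
    by_contra! hpos
    have hpos' : 0 < α := by exact_mod_cast hpos
    refine hα.ne ?_
    rw [SPlus, EReal.neg_eq_top_iff, EReal.eq_bot_iff_forall_lt]
    intro y
    obtain ⟨B, hB⟩ := exists_nat_gt (-y)
    have hev : ∀ᶠ T in Filter.atTop,
        tailRate (schrodingerOp V hV) α T ≤ ((-(B : ℝ) : ℝ) : EReal) :=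
      ((h α hpos' B).and (Filter.eventually_gt_atTop 1)).mono
        fun T hT => tailRate_le hT.2 hT.1
    refine (Filter.limsup_le_of_le (by isBoundedDefault) hev).trans_lt ?_
    exact_mod_cast (by linarith : -(B : ℝ) < y)
  · refine le_sSup ⟨0, ⟨le_rfl, ?_⟩, rfl⟩
    have h0 : (fun T => tailRate (schrodingerOp V hV) 0 T) =ᶠ[Filter.atTop] fun _ => 0 := by
      filter_upwards [Filter.eventually_gt_atTop 0] with T hT using tailRate_zero V hV hT
    rw [SPlus, Filter.limsup_congr h0, Filter.limsup_const]
    simp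

theorem le_zero_of_forall_pos_le {x : EReal} (h : ∀ r : ℝ, 0 < r → x ≤ (r : EReal)) : x ≤ 0 := by
  by_contra! hx
  obtain ⟨r, h1, h2⟩ := EReal.lt_iff_exists_real_btwn.1 hx
  exact absurd (h r (by exact_mod_cast h1)) (not_le.2 h2)

theorem zero_le_of_forall_neg_le {x : EReal} (h : ∀ r : ℝ, r < 0 → (r : EReal) ≤ x) : 0 ≤ x := by
  by_contra! hx
  obtain ⟨r, h1, h2⟩ := EReal.lt_iff_exists_real_btwn.1 hx
  exact absurd (h r (by exact_mod_cast h2)) (not_le.2 h1)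

theorem momentRate_le {M : ℝ≥0∞} {α p T : ℝ} (hp : 0 < p) (hα : 0 < α) (hT : 1 < T)
    (hT2 : Real.log 2 / (p * α) ≤ Real.log T) (h : M ≤ ENNReal.ofReal (2 * T ^ (α * p))) :
    ENNReal.log M / ((p * Real.log T : ℝ) : EReal) ≤ ((2 * α : ℝ) : EReal) := by
  have hlog : 0 < Real.log T := Real.log_pos hT
  have hT0 : 0 < T := by linarith
  have h1 : ENNReal.log M ≤ ((Real.log 2 + α * p * Real.log T : ℝ) : EReal) := by
    refine (ENNReal.log_monotone h).trans_eq ?_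
    rw [ENNReal.log_ofReal_of_pos (by positivity), Real.log_mul (by norm_num) (by positivity),
      Real.log_rpow hT0]
  refine (EReal.div_le_div_right_of_nonneg
    (by exact_mod_cast (by positivity : 0 ≤ p * Real.log T)) h1).trans ?_
  rw [← EReal.coe_div]
  refine EReal.coe_le_coe_iff.2 ?_
  rw [div_le_iff₀ (by positivity)] at *
  nlinarith

theorem le_momentRate {M : ℝ≥0∞} {c p T r : ℝ} (hp : 0 < p) (hc : 0 < c) (hr : r < 0)
    (hT : 1 < T) (hT2 : -Real.log c / (p * -r) ≤ Real.log T) (h : ENNReal.ofReal c ≤ M) :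
    (r : EReal) ≤ ENNReal.log M / ((p * Real.log T : ℝ) : EReal) := by
  have hlog : 0 < Real.log T := Real.log_pos hT
  have h1 : ((Real.log c : ℝ) : EReal) ≤ ENNReal.log M := by
    refine le_of_eq_of_le ?_ (ENNReal.log_monotone h)
    rw [ENNReal.log_ofReal_of_pos hc]
  refine le_trans ?_ (EReal.div_le_div_right_of_nonneg
    (by exact_mod_cast (by positivity : 0 ≤ p * Real.log T)) h1)
  rw [← EReal.coe_div]
  refine EReal.coe_le_coe_iff.2 ?_
  rw [le_div_iff₀ (by positivity)]
  rw [div_le_iff₀ (mul_pos hp (by linarith))] at hT2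
  linarith

theorem eventually_le_momentRate {lam : ℝ} (hl : 0 ≤ lam) (θ ω : ℝ) {p : ℝ} (hp : 0 < p) {r : ℝ}
    (hr : r < 0) : ∀ᶠ T in Filter.atTop, (r : EReal) ≤
      ENNReal.log (avgMoment (almostMathieu lam θ ω) p T) / ((p * Real.log T : ℝ) : EReal) := by
  obtain ⟨c, hc, h⟩ := le_avgMoment_almostMathieu hl
  filter_upwards [Filter.eventually_gt_atTop 1, Real.tendsto_log_atTop.eventually_ge_atTop
    (-Real.log c / (p * -r))] with T hT hT2
  exact le_momentRate hp hc hr hT hT2 (h θ ω p T hp hT.le)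

theorem zero_le_betaMinus {lam : ℝ} (hl : 0 ≤ lam) (θ ω : ℝ) {p : ℝ} (hp : 0 < p) :
    0 ≤ betaMinus (almostMathieu lam θ ω) p :=
  zero_le_of_forall_neg_le fun _ hr =>
    Filter.le_liminf_of_le (by isBoundedDefault) (eventually_le_momentRate hl θ ω hp hr)

theorem betaMinus_le_betaPlus (H : ℓ²(ℤ, ℂ) →L[ℂ] ℓ²(ℤ, ℂ)) (p : ℝ) :
    betaMinus H p ≤ betaPlus H p := Filter.liminf_le_limsup

theorem theorem2p4 (lam θ : ℝ) (hlam : 2 < lam) (hθ : Irrational θ) :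
    (∀ ω ∈ Set.Ico (0 : ℝ) 1,
      alphaUMinus (almostMathieu lam θ ω) = 0 ∧
      ∀ p : ℝ, 0 < p → betaMinus (almostMathieu lam θ ω) p = 0) ∧
    (WeakBrjuno θ → ∀ ω ∈ Set.Ico (0 : ℝ) 1,
      alphaUPlus (almostMathieu lam θ ω) = 0 ∧
      ∀ p : ℝ, 0 < p → betaPlus (almostMathieu lam θ ω) p = 0) := by
  have hl0 : 0 ≤ lam := by linarith
  have hR : 0 ≤ lam + 4 := by linarith
  have hlogT : ∀ p α : ℝ, ∀ᶠ T in Filter.atTop, Real.log 2 / (p * α) ≤ Real.log T := fun p α =>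
    Real.tendsto_log_atTop.eventually_ge_atTop _
  refine ⟨fun ω _ => ⟨?_, fun p hp => ?_⟩, fun hB ω _ => ⟨?_, fun p hp => ?_⟩⟩
  · refine alphaUMinus_eq_zero fun α hα B => ?_
    obtain ⟨s, T₁, h⟩ := outsideProb_almostMathieu_le hlam hα B
    exact ((frequently_localizingScale hlam hθ hR hα s).and_eventually
      (Filter.eventually_ge_atTop T₁)).mono fun T hT => h θ T hT.2 hT.1 ω
  · refine le_antisymm (le_zero_of_forall_pos_le fun r hr => ?_) (zero_le_betaMinus hl0 θ ω hp)
    obtain ⟨s, T₁, h⟩ := avgMoment_almostMathieu_le hlam (half_pos hr) hp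
    refine Filter.liminf_le_of_frequently_le'
      (((frequently_localizingScale hlam hθ hR (half_pos hr) s).and_eventually
        ((Filter.eventually_ge_atTop T₁).and ((Filter.eventually_gt_atTop 1).and
          (hlogT p (r / 2))))).mono fun T hT => ?_)
    have := momentRate_le hp (half_pos hr) hT.2.2.1 hT.2.2.2 (h θ T hT.2.1 hT.1 ω)
    rwa [mul_div_cancel₀ r two_ne_zero] at this
  · refine alphaUPlus_eq_zero fun α hα B => ?_
    obtain ⟨s, T₁, h⟩ := outsideProb_almostMathieu_le hlam hα B
    exact ((eventually_localizingScale hlam hθ hB hR hα s).and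
      (Filter.eventually_ge_atTop T₁)).mono fun T hT => h θ T hT.2 hT.1 ω
  · refine le_antisymm (le_zero_of_forall_pos_le fun r hr => ?_)
      ((zero_le_betaMinus hl0 θ ω hp).trans (betaMinus_le_betaPlus _ p))
    obtain ⟨s, T₁, h⟩ := avgMoment_almostMathieu_le hlam (half_pos hr) hp
    refine Filter.limsup_le_of_le (by isBoundedDefault)
      (((eventually_localizingScale hlam hθ hB hR (half_pos hr) s).and
        ((Filter.eventually_ge_atTop T₁).and ((Filter.eventually_gt_atTop 1).and
          (hlogT p (r / 2))))).mono fun T hT => ?_)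
    have := momentRate_le hp (half_pos hr) hT.2.2.1 hT.2.2.2 (h θ T hT.2.1 hT.1 ω)
    rwa [mul_div_cancel₀ r two_ne_zero] at this
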